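/- Let $\mathcal H_+\subset\mathcal H\subset\mathcal H_-$ be a Hilbert rigging: $\mathcal H$ is a complex Hilbert space, $\mathcal H_+$ is a dense subspace of $\mathcal H$ which is itself a Hilbert space for another inner product with $\|u\|_{\mathcal H}\le\|u\|_{\mathcal H_+}$ for all $u\in\mathcal H_+$, and $\mathcal H_-$ is the completion of $\mathcal H$ for the norm $\|u\|_{\mathcal H_-}=\sup\{|(f,u)_{\mathcal H}| : f\in\mathcal H_+,\ \|f\|_{\mathcal H_+}=1\}$. Let $I\subset\mathbb R$ be a compact interval and let $(A(t))_{t\in I}$ be self-adjoint operators on $\mathcal H$ such that, for every $t\in I$, $\mathcal D(A(t))\cap\mathcal H_+$ is dense in $\mathcal H_+$ and the restriction of $A(t)$ to $\mathcal D(A(t))\cap\mathcal H_+$ extends to a bounded operator in $\mathcal L(\mathcal H_+,\mathcal H_-)$, again denoted $A(t)$. Assume: (i) $I\ni t\mapsto A(t)\in\mathcal L(\mathcal H_+,\mathcal H_-)$ is norm continuous; (ii) for every $t\in I$ the unitary group $e^{i\tau A(t)}$, $\tau\in\mathbb R$, restricts to bounded operators on $\mathcal H_+$, and $\mathbb R\ni\tau\mapsto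 e^{i\tau A(t)}\in\mathcal L(\mathcal H_+)$ is strongly continuous; (iii) there are Hilbertian norms $(\|\cdot\|_t)_{t\in I}$ on $\mathcal H_+$ (norms coming from inner products), each equivalent to $\|\cdot\|_{\mathcal H_+}$, and a constant $c>0$ such that for all $t,s\in I$, $\tau\in\mathbb R$ and $\psi\in\mathcal H_+$, $$\|\psi\|_t\le e^{c|t-s|}\|\psi\|_s\quad\text{and}\quad \|e^{i\tau A(t)}\psi\|_t\le e^{c|\tau|}\|\psi\|_t .$$ Then the non-autonomous equation $i\partial_t u=A(t)u$, $t\in I$, has a unique unitary propagator, that is, there is exactly one family $(U(t,s))_{t,s\in I}$ such that (a) each $U(t,s)$ is a unitary operator on $\mathcal H$; (b) $U(t,t)=1$ and $U(t,s)U(s,r)=U(t,r)$ for all $t,s,r\in I$; (c) each $U(t,s)$ restricts to a bounded operator on $\mathcal H_+$, and for all $s\in I$ and $\psi\in\mathcal H_+$ the map $t\mapsto U(t,s)\psi$ is continuous from $I$ to $\mathcal H_+$ and continuously differentiable from $I$ to $\mathcal H_-$, with $i\partial_tU(t,s)\psi=A(t)U(t,s)\psi$ for all $t\in I$ (one-sided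 derivatives at the end points of $I$). Moreover, with the same constant $c$, $$\|U(t,s)\psi\|_t\le e^{2c|t-s|}\|\psi\|_s\qquad\text{for all }t,s\in I,\ \psi\in\mathcal H_+ .$$ -/

import Mathlib

/-- A Hilbert rigging: a dense subspace `Hp` of the Hilbert space `H`, which is itself a Hilbert
space for another inner product, with a norm dominating that of `H`. The inclusion of the subspace
is the injective map `incl`. -/
structure HilbertRigging (Hp H : Type*)
    [NormedAddCommGroup Hp] [InnerProductSpace ℂ Hp] [CompleteSpace Hp]
    [NormedAddCommGroup H] [InnerProductSpace ℂ H] [CompleteSpace H] where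
  incl : Hp →L[ℂ] H
  incl_injective : Function.Injective incl
  denseRange_incl : DenseRange incl
  norm_incl_le : ∀ u : Hp, ‖incl u‖ ≤ ‖u‖

namespace HilbertRigging

section

variable {Hp H : Type*}
  [NormedAddCommGroup Hp] [InnerProductSpace ℂ Hp] [CompleteSpace Hp]
  [NormedAddCommGroup H] [InnerProductSpace ℂ H] [CompleteSpace H]

/-- The norm `‖u‖_{H₋} = sup { |(f, u)_H| : f ∈ H₊, ‖f‖_{H₊} = 1 }` of a vector `u` of `H`. -/
noncomputable def minusNorm (R : HilbertRigging Hp H) (u : H) : ℝ :=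
  ⨆ f : {f : Hp // ‖f‖ = 1}, ‖inner ℂ (R.incl f) u‖

theorem norm_inner_incl_le (R : HilbertRigging Hp H) (u : H) (f : {f : Hp // ‖f‖ = 1}) :
    ‖inner ℂ (R.incl f) u‖ ≤ ‖u‖ := by
  have h1 : ‖R.incl f‖ ≤ 1 := (R.norm_incl_le f).trans f.2.le
  calc ‖inner ℂ (R.incl f) u‖ ≤ ‖R.incl f‖ * ‖u‖ := norm_inner_le_norm _ _
    _ ≤ 1 * ‖u‖ := by gcongr
    _ = ‖u‖ := one_mul _

theorem bddAbove_minusNorm (R : HilbertRigging Hp H) (u : H) :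
    BddAbove (Set.range fun f : {f : Hp // ‖f‖ = 1} => ‖inner ℂ (R.incl f) u‖) :=
  ⟨‖u‖, by rintro _ ⟨f, rfl⟩; exact R.norm_inner_incl_le u f⟩

theorem minusNorm_le (R : HilbertRigging Hp H) (u : H) : R.minusNorm u ≤ ‖u‖ :=
  Real.iSup_le (R.norm_inner_incl_le u) (norm_nonneg u)

theorem minusNorm_nonneg (R : HilbertRigging Hp H) (u : H) : 0 ≤ R.minusNorm u :=
  Real.iSup_nonneg fun _ => norm_nonneg _

theorem minusNorm_add_le (R : HilbertRigging Hp H) (u v : H) :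
    R.minusNorm (u + v) ≤ R.minusNorm u + R.minusNorm v := by
  refine Real.iSup_le (fun f => ?_) (add_nonneg (R.minusNorm_nonneg u) (R.minusNorm_nonneg v))
  rw [inner_add_right]
  exact (norm_add_le _ _).trans
    (add_le_add (le_ciSup (R.bddAbove_minusNorm u) f) (le_ciSup (R.bddAbove_minusNorm v) f))

theorem minusNorm_smul (R : HilbertRigging Hp H) (c : ℂ) (u : H) :
    R.minusNorm (c • u) = ‖c‖ * R.minusNorm u := by
  simp only [minusNorm, inner_smul_right, norm_mul]
  rw [Real.mul_iSup_of_nonneg (norm_nonneg c)]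

/-- The vector space `H`, to be equipped with the norm `‖·‖_{H₋}` instead of its own norm. -/
def PreMinus (_R : HilbertRigging Hp H) : Type _ := H

noncomputable instance (R : HilbertRigging Hp H) : AddCommGroup R.PreMinus :=
  inferInstanceAs (AddCommGroup H)

noncomputable instance (R : HilbertRigging Hp H) : Module ℂ R.PreMinus :=
  inferInstanceAs (Module ℂ H)

noncomputable instance (R : HilbertRigging Hp H) : Norm R.PreMinus := ⟨R.minusNorm⟩

theorem preMinus_core (R : HilbertRigging Hp H) : SeminormedSpace.Core ℂ R.PreMinus where
  norm_nonneg := R.minusNorm_nonneg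
  norm_smul := R.minusNorm_smul
  norm_triangle := R.minusNorm_add_le

noncomputable instance (R : HilbertRigging Hp H) : SeminormedAddCommGroup R.PreMinus :=
  SeminormedAddCommGroup.ofCore R.preMinus_core

noncomputable instance (R : HilbertRigging Hp H) : NormedSpace ℂ R.PreMinus where
  norm_smul_le c u := (R.minusNorm_smul c u).le

/-- The space `H₋`: the completion of `H` with respect to the norm `‖·‖_{H₋}`. -/
abbrev Minus (R : HilbertRigging Hp H) : Type _ := UniformSpace.Completion R.PreMinus

/-- The inclusion of `H` into `H₋`. -/
noncomputable def toMinus (R : HilbertRigging Hp H) : H →L[ℂ] R.Minus :=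
  (UniformSpace.Completion.toComplL (𝕜 := ℂ) (E := R.PreMinus)).comp
    (LinearMap.mkContinuous (F := R.PreMinus) (LinearMap.id : H →ₗ[ℂ] H) 1
      fun u => (R.minusNorm_le u).trans_eq (one_mul ‖u‖).symm)

/-- `S`, an operator on `H₊`, is the restriction of `T`, an operator on `H`. -/
def Restricts (R : HilbertRigging Hp H) (T : H →L[ℂ] H) (S : Hp →L[ℂ] Hp) : Prop :=
  ∀ u : Hp, R.incl (S u) = T (R.incl u)

/-- `B ∈ L(H₊, H₋)` is an extension of the (unbounded) operator `A` on `H`, that is, of the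
restriction of `A` to `D(A) ∩ H₊`. -/
def IsExtension (R : HilbertRigging Hp H) (A : H →ₗ.[ℂ] H) (B : Hp →L[ℂ] R.Minus) : Prop :=
  ∀ (u : Hp) (hu : R.incl u ∈ A.domain), B u = R.toMinus (A ⟨R.incl u, hu⟩)

/-- `U` is a unitary propagator, with restriction `Up` to `H₊`, of the non-autonomous equation
`i ∂ₜ u = B(t) u`, `t ∈ I`, where `B(t) ∈ L(H₊, H₋)`. Derivatives are those of `H₋`-valued
functions on `I` (one-sided at the end points of `I`). The fields `continuousOn`, `hasDeriv` and
`continuousOn_deriv` say that `t ↦ U(t, s)` is continuous with values in `L(H₊)` and continuously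
differentiable with values in `L(H₊, H₋)`, both for the strong operator topology, with
`∂ₜ U(t, s) ψ = -i B(t) U(t, s) ψ`. -/
structure IsUnitaryPropagator (R : HilbertRigging Hp H) (I : Set ℝ)
    (B : ℝ → Hp →L[ℂ] R.Minus) (U : ℝ → ℝ → H →L[ℂ] H) (Up : ℝ → ℝ → Hp →L[ℂ] Hp) : Prop where
  mem_unitary : ∀ t ∈ I, ∀ s ∈ I, U t s ∈ unitary (H →L[ℂ] H)
  self : ∀ t ∈ I, U t t = 1
  mul : ∀ t ∈ I, ∀ s ∈ I, ∀ r ∈ I, U t s * U s r = U t r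
  restricts : ∀ t ∈ I, ∀ s ∈ I, R.Restricts (U t s) (Up t s)
  continuousOn : ∀ s ∈ I, ∀ ψ : Hp, ContinuousOn (fun t => Up t s ψ) I
  hasDeriv : ∀ s ∈ I, ∀ ψ : Hp, ∀ t ∈ I,
    HasDerivWithinAt (fun τ => R.toMinus (R.incl (Up τ s ψ))) (-Complex.I • B t (Up t s ψ)) I t
  continuousOn_deriv : ∀ s ∈ I, ∀ ψ : Hp,
    ContinuousOn (fun t => -Complex.I • B t (Up t s ψ)) I

end

end HilbertRigging

/-- `W` is a strongly continuous one-parameter unitary group whose infinitesimal generator is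
exactly `i A`: `τ ↦ W τ ψ` is differentiable at `0` iff `ψ ∈ D(A)`, and the derivative is then
`i A ψ`. -/
structure IsUnitaryGroupOf {H : Type*} [NormedAddCommGroup H] [InnerProductSpace ℂ H]
    [CompleteSpace H] (A : H →ₗ.[ℂ] H) (W : ℝ → H →L[ℂ] H) : Prop where
  mem_unitary : ∀ τ, W τ ∈ unitary (H →L[ℂ] H)
  zero : W 0 = 1
  add : ∀ σ τ, W (σ + τ) = W σ * W τ
  continuous : ∀ ψ, Continuous fun τ => W τ ψ
  generator : ∀ ψ φ : H,
    HasDerivAt (fun τ : ℝ => W τ ψ) φ 0 ↔ ∃ h : ψ ∈ A.domain, φ = Complex.I • A ⟨ψ, h⟩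

/-- The group of a given self-adjoint operator is unique. -/
theorem IsUnitaryGroupOf.unique {H : Type*} [NormedAddCommGroup H] [InnerProductSpace ℂ H]
    [CompleteSpace H] {A : H →ₗ.[ℂ] H} (hA : IsSelfAdjoint A) {V W : ℝ → H →L[ℂ] H}
    (hV : IsUnitaryGroupOf A V) (hW : IsUnitaryGroupOf A W) : V = W := by
  have hdense : Dense (A.domain : Set H) := hA.dense_domain
  have hsymm : ∀ x y : A.domain, inner ℂ (A x) (y : H) = inner ℂ (x : H) (A y) := by
    have h := LinearPMap.adjoint_isFormalAdjoint hdense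
    rw [LinearPMap.isSelfAdjoint_def.mp hA] at h
    exact fun x y => h x y
  have key : ∀ {W : ℝ → H →L[ℂ] H}, IsUnitaryGroupOf A W → ∀ (ψ : A.domain) (τ : ℝ),
      ∃ h : W τ ψ ∈ A.domain,
        HasDerivAt (fun σ => W σ ψ) (Complex.I • A ⟨W τ ψ, h⟩) τ := by
    intro W hW ψ τ
    have h0 := (hW.generator ψ _).mpr ⟨ψ.2, rfl⟩
    have h1 : HasDerivAt (fun σ => W τ (W σ ψ)) (W τ (Complex.I • A ψ)) 0 :=
      ((W τ).restrictScalars ℝ).hasFDerivAt.comp_hasDerivAt 0 h0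
    have h2 : (fun σ => W τ (W σ ψ)) = fun σ => W σ (W τ ψ) := by
      ext σ
      change (W τ * W σ) ψ = (W σ * W τ) ψ
      rw [← hW.add, ← hW.add, add_comm]
    obtain ⟨hd, he⟩ := (hW.generator (W τ ψ) (W τ (Complex.I • A ψ))).mp (h2 ▸ h1)
    refine ⟨hd, ?_⟩
    rw [← he]
    have h3 : HasDerivAt (fun σ => W τ (W (σ - τ) ψ)) (W τ (Complex.I • A ψ)) τ := by
      have h1' : HasDerivAt (fun σ => W τ (W σ ψ)) (W τ (Complex.I • A ψ)) (τ - τ) := by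
        simpa using h1
      exact h1'.comp_sub_const τ τ
    convert h3 using 2 with σ
    change W σ ψ = (W τ * W (σ - τ)) ψ
    rw [← hW.add]
    congr 2
    ring
  have hinner : ∀ (φ ψ : A.domain) (τ : ℝ), inner ℂ (V τ φ) (W τ ψ) = inner ℂ (φ : H) (ψ : H) := by
    intro φ ψ
    have hd : ∀ τ, HasDerivAt (fun σ => inner ℂ (V σ φ) (W σ ψ)) 0 τ := by
      intro τ
      obtain ⟨h1, h1'⟩ := key hV φ τ
      obtain ⟨h2, h2'⟩ := key hW ψ τ
      refine (h1'.inner ℂ h2').congr_deriv ?_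
      rw [inner_smul_left, inner_smul_right]
      have := hsymm ⟨_, h1⟩ ⟨_, h2⟩
      simp only at this
      rw [this]
      simp
    intro τ
    have := is_const_of_deriv_eq_zero (fun τ => (hd τ).differentiableAt) (fun τ => (hd τ).deriv) τ 0
    simpa [hV.zero, hW.zero] using this
  ext τ x
  revert x
  have hVW : Set.EqOn (V τ) (W τ) A.domain := by
    intro ψ hψ
    have h4 : star (V τ) (W τ ψ) = ψ := by
      refine hdense.eq_of_inner_right ℂ fun φ hφ => ?_
      rw [ContinuousLinearMap.star_eq_adjoint, ContinuousLinearMap.adjoint_inner_right]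
      exact hinner ⟨φ, hφ⟩ ⟨ψ, hψ⟩ τ
    have h5 : (V τ * star (V τ)) (W τ ψ) = W τ ψ := by
      rw [Unitary.mul_star_self_of_mem (hV.mem_unitary τ)]; rfl
    rw [← h5]
    change V τ ψ = V τ (star (V τ) (W τ ψ))
    rw [h4]
  exact fun x => congrFun ((V τ).continuous.ext_on hdense (W τ).continuous hVW) x

open Classical in
/-- The unitary group `τ ↦ e^{iτA}` of a self-adjoint operator `A`: the unique strongly continuous
one-parameter unitary group with generator `i A`. (The value for operators that do not generate
such a group is irrelevant: every self-adjoint operator does.) -/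
noncomputable def expI {H : Type*} [NormedAddCommGroup H] [InnerProductSpace ℂ H]
    [CompleteSpace H] (A : H →ₗ.[ℂ] H) (τ : ℝ) : H →L[ℂ] H :=
  if h : ∃ W : ℝ → H →L[ℂ] H, IsUnitaryGroupOf A W then h.choose τ else 0

/-- `N` is a Hilbertian norm on `E`: it is the norm of some (positive definite) inner product. -/
def IsHilbertianNorm {E : Type*} [AddCommGroup E] [Module ℂ E] (N : E → ℝ) : Prop :=
  ∃ core : InnerProductSpace.Core ℂ E, ∀ u, N u = √(core.inner u u).re

/-- `N` is equivalent to the given norm of `E`. -/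
def IsEquivalentNorm {E : Type*} [NormedAddCommGroup E] (N : E → ℝ) : Prop :=
  ∃ C : ℝ, 0 < C ∧ ∀ u, N u ≤ C * ‖u‖ ∧ ‖u‖ ≤ C * N u

/-! Write `ι` for the inclusion of `H₊` in `H`. The norm of `H₋` on `u ∈ H` is `‖ι* u‖`, so `ι*`
extends to an isometry `J` of `H₋` into `H₊`, and the equation becomes `i ∂ₜ(ι*ι u) = J B(t) u`
inside the single Hilbert space `E = H₊`, with symmetric operators `J B(t)`.

Everything rests on an energy estimate (`norm_sq_sub_le`): if `u₁` and `u₂` solve such equations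
with symmetric operators `ε`-close to `J B(t)` and stay bounded by `M` in `E`, symmetry cancels the
main term and `‖ι(u₁ - u₂)‖²` varies at rate `O(M² ε)`. With `ε = 0` this is conservation, hence
uniqueness, linearity and isometry of the solution maps. With `ε → 0` it gives convergence.

Approximate solutions come from freezing `A(t)` on short intervals. Over an interval of length `τ`
the frozen group costs `e^{cτ}` and the change of norm `‖·‖_t` another `e^{cτ}`, so the total is
`e^{2c|t-s|}` whatever the mesh (`norm_frozen_le`). The energy estimate makes these approximations
Cauchy in `H`. Being bounded in `E`, they converge weakly there, and weak lower semicontinuity hands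
the stability bound to the limit.

Regularity is first proved at the initial time only: near `s` the bound makes the norm at most
slightly larger than that of the initial vector, and together with weak closeness this forces strong
closeness, uniformly along the sequence. Then the first order expansion of `ι*ι u` at `s` passes to
the limit. Any other time `t₀` is reduced to this case by restarting at `t₀`, since the restarted
limit is the same function (`eqOn_restart`).

Finally, `expI` is defined by choice, so the existence half of Stone's theorem is needed. It is
obtained from the commuting bounded operators `A λ² (A² + λ²)⁻¹`, `λ → ∞`. -/

open Filter Topology Set

/-! ### Resolvents and bounded approximations of a self-adjoint operator. -/

namespace SelfAdjointGroup

variable {H : Type*} [NormedAddCommGroup H] [InnerProductSpace ℂ H] {A : H →ₗ.[ℂ] H}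

/-- The operator `A + i l` on the domain of `A`. -/
noncomputable def shift (A : H →ₗ.[ℂ] H) (l : ℝ) : A.domain →ₗ[ℂ] H :=
  A.toFun + (l * Complex.I) • A.domain.subtype

@[simp] theorem shift_apply (l : ℝ) (x : A.domain) :
    shift A l x = A x + (l * Complex.I) • (x : H) := rfl

variable [CompleteSpace H]

theorem inner_apply_left (hA : IsSelfAdjoint A) (x y : A.domain) :
    inner ℂ (A x) (y : H) = inner ℂ (x : H) (A y) := by
  have h := LinearPMap.adjoint_isFormalAdjoint hA.dense_domain
  rw [LinearPMap.isSelfAdjoint_def.mp hA] at h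
  exact h x y

/-- The hypothesis puts `(y, w)` in the graph of the adjoint, which is the graph of `A`. This is the
only way membership in the domain is ever produced from a weak identity. -/
theorem mem_domain_of_inner (hA : IsSelfAdjoint A) {y w : H}
    (h : ∀ x : A.domain, inner ℂ w (x : H) = inner ℂ y (A x)) :
    ∃ hy : y ∈ A.domain, A ⟨y, hy⟩ = w := by
  have h1 := LinearPMap.mem_adjoint_domain_of_exists y ⟨w, h⟩
  have h2 := LinearPMap.adjoint_apply_eq hA.dense_domain ⟨y, h1⟩ h
  have h3 := LinearPMap.isSelfAdjoint_def.mp hA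
  have hg : ((y, w) : H × H) ∈ (LinearPMap.adjoint A).graph := by
    rw [LinearPMap.mem_graph_iff]
    exact ⟨⟨y, h1⟩, rfl, h2⟩
  rw [h3, LinearPMap.mem_graph_iff] at hg
  obtain ⟨z, hz, hz'⟩ := hg
  simp only at hz hz'
  subst hz
  exact ⟨z.2, hz'⟩

theorem inner_self_im (hA : IsSelfAdjoint A) (x : A.domain) :
    (inner ℂ (x : H) (A x)).im = 0 := by
  have h := inner_apply_left hA x x
  have h2 := inner_conj_symm (𝕜 := ℂ) (x : H) (A x)
  rw [h] at h2
  exact Complex.conj_eq_iff_im.mp h2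

/-- The cross term vanishes because `⟪x, A x⟫` is real. -/
theorem norm_add_smul_sq (hA : IsSelfAdjoint A) (l : ℝ) (x : A.domain) :
    ‖A x + (l * Complex.I) • (x : H)‖ ^ 2 = ‖A x‖ ^ 2 + l ^ 2 * ‖(x : H)‖ ^ 2 := by
  rw [@norm_add_sq ℂ, inner_smul_right, norm_smul, mul_pow, inner_apply_left hA]
  have := inner_self_im hA x
  simp [this]

theorem le_norm_add_smul (hA : IsSelfAdjoint A) (l : ℝ) (x : A.domain) :
    |l| * ‖(x : H)‖ ≤ ‖A x + (l * Complex.I) • (x : H)‖ := by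
  refine abs_le_of_sq_le_sq' ?_ (norm_nonneg _) |>.2
  rw [norm_add_smul_sq hA, mul_pow, sq_abs]
  nlinarith [sq_nonneg ‖A x‖]

theorem shift_injective (hA : IsSelfAdjoint A) {l : ℝ} (hl : l ≠ 0) :
    Function.Injective (shift A l) := by
  rw [injective_iff_map_eq_zero]
  intro x hx
  have h := le_norm_add_smul hA l x
  rw [← shift_apply, hx, norm_zero] at h
  have : ‖(x : H)‖ ≤ 0 := by
    by_contra! h'
    have := mul_pos (abs_pos.mpr hl) h'
    linarith
  exact Subtype.ext (norm_le_zero_iff.mp this)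

/-- The lower bound `|l| ‖x‖ ≤ ‖(A + i l) x‖` makes the preimages of a convergent sequence Cauchy,
and the graph of `A` is closed. -/
theorem isClosed_range_shift (hA : IsSelfAdjoint A) {l : ℝ} (hl : l ≠ 0) :
    IsClosed (LinearMap.range (shift A l) : Set H) := by
  rw [← isSeqClosed_iff_isClosed]
  intro y z hy hz
  choose x hx using hy
  have hxc : CauchySeq fun n => ((x n : A.domain) : H) := by
    rw [Metric.cauchySeq_iff]
    intro ε hε
    obtain ⟨N, hN⟩ := Metric.cauchySeq_iff.mp hz.cauchySeq (|l| * ε) (by positivity)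
    refine ⟨N, fun m hm n hn => ?_⟩
    have h := hN m hm n hn
    rw [dist_eq_norm, ← hx, ← hx, ← map_sub] at h
    have h2 := (le_norm_add_smul hA l (x m - x n)).trans_lt h
    rw [dist_eq_norm]
    exact lt_of_mul_lt_mul_left h2 (abs_nonneg l)
  obtain ⟨w, hw⟩ := cauchySeq_tendsto_of_complete hxc
  have hA1 : Tendsto (fun n => A (x n)) atTop (𝓝 (z - (l * Complex.I) • w)) := by
    have : (fun n => A (x n)) = fun n => y n - (l * Complex.I) • ((x n : A.domain) : H) := by
      ext n
      rw [← hx n, shift_apply]; simp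
    rw [this]
    exact hz.sub (hw.const_smul _)
  have hcl : IsClosed (A.graph : Set (H × H)) := hA.isClosed
  have hmem : (w, z - (l * Complex.I) • w) ∈ (A.graph : Set (H × H)) :=
    hcl.mem_of_tendsto (hw.prodMk_nhds hA1) (Eventually.of_forall fun n => A.mem_graph (x n))
  rw [SetLike.mem_coe, LinearPMap.mem_graph_iff] at hmem
  obtain ⟨v, hv, hv'⟩ := hmem
  refine ⟨v, ?_⟩
  simp only at hv hv'
  rw [shift_apply, hv', hv]; simp

/-- A vector orthogonal to the closed range of `A + i l` is in the domain of `A* = A` and is killed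
by `A - i l`, which is injective. -/
theorem shift_surjective (hA : IsSelfAdjoint A) {l : ℝ} (hl : l ≠ 0) :
    Function.Surjective (shift A l) := by
  rw [← LinearMap.range_eq_top]
  have hcl := isClosed_range_shift hA hl
  have : CompleteSpace (LinearMap.range (shift A l)) := hcl.completeSpace_coe
  rw [← Submodule.orthogonal_eq_bot_iff, eq_bot_iff]
  intro y hy
  rw [Submodule.mem_orthogonal'] at hy
  have h1 : ∀ x : A.domain, inner ℂ ((l * Complex.I) • y) (x : H) = inner ℂ y (A x) := by
    intro x
    have h2 := hy _ ⟨x, rfl⟩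
    rw [shift_apply, inner_add_right, inner_smul_right] at h2
    rw [inner_smul_left]
    simp only [map_mul, Complex.conj_ofReal, Complex.conj_I]
    linear_combination -h2
  obtain ⟨hyd, hAy⟩ := mem_domain_of_inner hA h1
  have h3 : shift A (-l) ⟨y, hyd⟩ = 0 := by
    rw [shift_apply, hAy, ← add_smul]; simp
  have h4 := shift_injective hA (neg_ne_zero.mpr hl) (h3.trans (map_zero _).symm)
  rw [Submodule.mem_bot]
  exact congrArg Subtype.val h4

/-- The resolvent `(A + i l)⁻¹` of a self-adjoint operator, for real `l ≠ 0`. -/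
theorem exists_resolvent (hA : IsSelfAdjoint A) {l : ℝ} (hl : l ≠ 0) :
    ∃ Q : H →L[ℂ] H, (∀ y, ∃ h : Q y ∈ A.domain, A ⟨Q y, h⟩ + (l * Complex.I) • Q y = y) ∧
      (∀ x : A.domain, Q (A x + (l * Complex.I) • (x : H)) = x) ∧
      (∀ y, |l| * ‖Q y‖ ≤ ‖y‖) := by
  let e := LinearEquiv.ofBijective (shift A l) ⟨shift_injective hA hl, shift_surjective hA hl⟩
  have he : ∀ y, A (e.symm y) + (l * Complex.I) • ((e.symm y : A.domain) : H) = y :=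
    fun y => e.apply_symm_apply y
  have hb : ∀ y, |l| * ‖((e.symm y : A.domain) : H)‖ ≤ ‖y‖ := fun y => by
    have := le_norm_add_smul hA l (e.symm y)
    rwa [he] at this
  refine ⟨(A.domain.subtype ∘ₗ e.symm.toLinearMap).mkContinuous |l|⁻¹ fun y => ?_, fun y => ?_,
    fun x => ?_, hb⟩
  · rw [inv_mul_eq_div, le_div_iff₀ (abs_pos.mpr hl), mul_comm]
    exact hb y
  · exact ⟨(e.symm y).2, he y⟩
  · exact congrArg Subtype.val (e.symm_apply_apply x)

theorem isSelfAdjoint_of_inner {T : H →L[ℂ] H}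
    (h : ∀ x y, inner ℂ (T x) y = inner ℂ x (T y)) : IsSelfAdjoint T :=
  ContinuousLinearMap.isSelfAdjoint_iff_isSymmetric.mpr h

/-- Bounded self-adjoint operators `T n`, commuting with each other, which converge strongly to `A`
on the domain of `A`. -/
theorem exists_approximation (hA : IsSelfAdjoint A) :
    ∃ T : ℕ → H →L[ℂ] H, (∀ n, IsSelfAdjoint (T n)) ∧ (∀ m n, Commute (T m) (T n)) ∧
      ∀ x : A.domain, Tendsto (fun n => T n x) atTop (𝓝 (A x)) := by
  choose! Q hQ1 hQ2 hQ3 using fun (l : ℝ) (hl : l ≠ 0) => exists_resolvent hA hl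
  have hadj : ∀ l : ℝ, l ≠ 0 → ∀ y z, inner ℂ (Q l y) z = inner ℂ y (Q (-l) z) := by
    intro l hl y z
    obtain ⟨h1, h1'⟩ := hQ1 l hl y
    obtain ⟨h2, h2'⟩ := hQ1 (-l) (neg_ne_zero.mpr hl) z
    have h3 := inner_apply_left hA ⟨_, h1⟩ ⟨_, h2⟩
    simp only at h3
    conv_lhs => rw [← h2']
    conv_rhs => rw [← h1']
    rw [inner_add_left, inner_add_right, h3, inner_smul_left, inner_smul_right]
    simp
  -- The first resolvent identity. Exchanging `l` and `m` in it yields commutation.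
  have hres : ∀ l m : ℝ, l ≠ 0 → m ≠ 0 →
      Q l - Q m = ((m - l) * Complex.I) • (Q l * Q m) := by
    intro l m hl hm
    ext y
    obtain ⟨h1, h1'⟩ := hQ1 m hm y
    have h2 := hQ2 l hl ⟨_, h1⟩
    have h3 : A ⟨_, h1⟩ + (l * Complex.I) • Q m y = y - ((m - l) * Complex.I) • Q m y := by
      rw [eq_sub_of_add_eq h1']
      module
    simp only at h2
    rw [h3, map_sub, map_smul] at h2
    simp only [sub_apply, smul_apply,
      mul_apply_eq_comp]
    exact sub_eq_of_eq_add (by rw [← sub_eq_iff_eq_add', h2])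
  have hcomm : ∀ l m : ℝ, l ≠ 0 → m ≠ 0 → Commute (Q l) (Q m) := by
    intro l m hl hm
    rcases eq_or_ne l m with rfl | hlm
    · exact Commute.refl _
    have h1 := hres l m hl hm
    have h2 := hres m l hm hl
    have h3 : ((m - l : ℂ) * Complex.I) • (Q l * Q m) = ((m - l) * Complex.I) • (Q m * Q l) := by
      rw [← h1, ← neg_sub (Q m), h2, ← neg_smul]
      congr 1; ring
    refine smul_right_injective _ (mul_ne_zero ?_ Complex.I_ne_zero) h3
    rw [sub_ne_zero]
    exact_mod_cast hlm.symm
  have hcast : ∀ n : ℕ, (n + 1 : ℝ) ≠ 0 := fun n => by positivity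
  have hcast' : ∀ n : ℕ, -(n + 1 : ℝ) ≠ 0 := fun n => neg_ne_zero.mpr (hcast n)
  -- `i l (A + i l)⁻¹` tends strongly to `1`: on the domain the error is `(A + i l)⁻¹ A x =
  -- O(1/|l|)`, and these operators are contractions, so density suffices.
  have hlim : ∀ l : ℕ → ℝ, (∀ n, |l n| = n + 1) → ∀ y : H,
      Tendsto (fun n => (l n * Complex.I) • Q (l n) y) atTop (𝓝 y) := by
    intro l hl
    have hl0 : ∀ n, l n ≠ 0 := fun n => by
      rw [← abs_pos, hl]; positivity
    have hb : ∀ n y, ‖(l n * Complex.I) • Q (l n) y‖ ≤ ‖y‖ := by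
      intro n y
      rw [norm_smul, norm_mul, Complex.norm_I, mul_one, Complex.norm_real]
      exact hQ3 _ (hl0 n) y
    have hD : ∀ x : A.domain, Tendsto (fun n => (l n * Complex.I) • Q (l n) (x : H)) atTop
        (𝓝 (x : H)) := by
      intro x
      rw [tendsto_iff_norm_sub_tendsto_zero]
      refine squeeze_zero (g := fun n : ℕ => ‖A x‖ * (1 / ((n : ℝ) + 1)))
        (fun n => norm_nonneg _) (fun n => ?_) ?_
      · have h1 := hQ2 (l n) (hl0 n) x
        have h2 : (l n * Complex.I) • Q (l n) (x : H) - x = - Q (l n) (A x) := by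
          rw [map_add, map_smul] at h1
          nth_rw 2 [← h1]; abel
        rw [h2, norm_neg]
        have := hQ3 _ (hl0 n) (A x)
        rw [hl] at this
        rw [mul_one_div, le_div_iff₀ (by positivity)]
        linarith
      · simpa using tendsto_one_div_add_atTop_nhds_zero_nat.const_mul ‖A x‖
    intro y
    rw [Metric.tendsto_atTop]
    intro ε hε
    obtain ⟨x, hx, hxy⟩ := Metric.dense_iff.mp hA.dense_domain y (ε / 3) (by positivity)
    obtain ⟨N, hN⟩ := Metric.tendsto_atTop.mp (hD ⟨_, hxy⟩) (ε / 3) (by positivity)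
    refine ⟨N, fun n hn => ?_⟩
    have h1 := hN n hn
    rw [Metric.mem_ball] at hx
    have h2 := hb n (y - x)
    rw [map_sub, smul_sub, ← dist_eq_norm, ← dist_eq_norm, dist_comm y] at h2
    calc _ ≤ dist _ ((l n * Complex.I) • Q (l n) x) + dist ((l n * Complex.I) • Q (l n) x) x
          + dist x y := dist_triangle4 _ _ _ _
      _ < ε := by simp only at h1; linarith
  -- With `λ = n + 1` this is `A λ² (A² + λ²)⁻¹`. It is symmetric because the adjoint of `Q l` is `Q
  -- (-l)`, and on the domain it is the mean of `± i λ Q (± λ)` applied to `A x`.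
  refine ⟨fun n => (((n + 1 : ℝ) ^ 2 / 2 : ℝ) : ℂ) • (Q (n + 1) + Q (-(n + 1))), fun n => ?_,
    fun m n => ?_, fun x => ?_⟩
  · refine isSelfAdjoint_of_inner fun x y => ?_
    simp only [smul_apply, add_apply, inner_smul_left,
      inner_smul_right, inner_add_left, inner_add_right]
    rw [hadj _ (hcast n), hadj _ (hcast' n), neg_neg, Complex.conj_ofReal,
      add_comm (inner ℂ x _)]
  · refine Commute.smul_left (Commute.smul_right ?_ _) _
    refine Commute.add_left ?_ ?_ <;> refine Commute.add_right ?_ ?_ <;> apply hcomm <;>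
      first | exact hcast _ | exact hcast' _
  · have h1 : ∀ n : ℕ, (((n + 1 : ℝ) ^ 2 / 2 : ℝ) : ℂ) • (Q (n + 1) + Q (-(n + 1))) (x : H) =
        (1 / 2 : ℂ) • ((((n + 1 : ℝ) * Complex.I) • Q (n + 1) (A x)) +
          (((-(n + 1) : ℝ) * Complex.I) • Q (-(n + 1)) (A x))) := by
      intro n
      have h2 := hQ2 _ (hcast n) x
      have h3 := hQ2 _ (hcast' n) x
      have h4 : Q (n + 1) (A x) = x - (((n + 1 : ℝ) * Complex.I) • Q (n + 1) (x : H)) := by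
        rw [eq_sub_iff_add_eq, ← map_smul, ← map_add]; exact h2
      have h5 : Q (-(n + 1)) (A x) = x - (((-(n + 1) : ℝ) * Complex.I) • Q (-(n + 1)) (x : H)) := by
        rw [eq_sub_iff_add_eq, ← map_smul, ← map_add]; exact h3
      rw [h4, h5, add_apply]
      push_cast
      match_scalars <;> ring_nf <;> simp <;> ring
    have h2 : Tendsto (fun n : ℕ => (1 / 2 : ℂ) • ((((n + 1 : ℝ) * Complex.I) • Q (n + 1) (A x)) +
          (((-(n + 1) : ℝ) * Complex.I) • Q (-(n + 1)) (A x)))) atTop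
        (𝓝 ((1 / 2 : ℂ) • (A x + A x))) := by
      refine ((hlim (fun n => n + 1) (fun n => ?_) (A x)).add
        (hlim (fun n => -(n + 1)) (fun n => ?_) (A x))).const_smul _
      · exact abs_of_pos (by positivity)
      · rw [abs_neg]; exact abs_of_pos (by positivity)
    rw [show (1 / 2 : ℂ) • (A x + A x) = A x by rw [← two_smul ℂ, smul_smul]; norm_num] at h2
    exact h2.congr fun n => (h1 n).symm

end SelfAdjointGroup

/-! ### The unitary group of a self-adjoint operator. -/

namespace SelfAdjointGroup

section Bounded

variable {H : Type*} [NormedAddCommGroup H] [InnerProductSpace ℂ H] [CompleteSpace H]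

/-- The group `τ ↦ e^{iτT}` of a bounded operator. -/
noncomputable def boundedGroup (T : H →L[ℂ] H) (τ : ℝ) : H →L[ℂ] H :=
  NormedSpace.exp (τ • (Complex.I • T))

theorem boundedGroup_zero (T : H →L[ℂ] H) : boundedGroup T 0 = 1 := by
  simp [boundedGroup]

theorem boundedGroup_add (T : H →L[ℂ] H) (σ τ : ℝ) :
    boundedGroup T (σ + τ) = boundedGroup T σ * boundedGroup T τ := by
  rw [boundedGroup, add_smul, NormedSpace.exp_add_of_commute_of_mem_ball (𝕂 := ℂ)]
  · rfl
  · exact ((Commute.refl _).smul_left σ).smul_right τ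
  all_goals rw [NormedSpace.expSeries_radius_eq_top]; exact edist_lt_top _ _

theorem boundedGroup_mem_unitary {T : H →L[ℂ] H} (hT : IsSelfAdjoint T) (τ : ℝ) :
    boundedGroup T τ ∈ unitary (H →L[ℂ] H) := by
  let +nondep : NormedAlgebra ℚ (H →L[ℂ] H) := .restrictScalars ℚ ℂ _
  refine NormedSpace.exp_mem_unitary_of_mem_skewAdjoint ?_
  rw [skewAdjoint.mem_iff, star_smul, star_smul, hT.star_eq]
  simp

theorem norm_boundedGroup_apply {T : H →L[ℂ] H} (hT : IsSelfAdjoint T) (τ : ℝ) (x : H) :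
    ‖boundedGroup T τ x‖ = ‖x‖ :=
  ContinuousLinearMap.norm_map_of_mem_unitary (boundedGroup_mem_unitary hT τ) x

theorem hasDerivAt_boundedGroup (T : H →L[ℂ] H) (x : H) (τ : ℝ) :
    HasDerivAt (fun σ => boundedGroup T σ x) (Complex.I • boundedGroup T τ (T x)) τ := by
  have h := hasDerivAt_exp_smul_const (𝕂 := ℝ) (Complex.I • T) τ
  have h2 := ((ContinuousLinearMap.apply ℂ H x).restrictScalars ℝ).hasFDerivAt.comp_hasDerivAt τ h
  refine h2.congr_deriv ?_
  change NormedSpace.exp (τ • Complex.I • T) (Complex.I • T x) = _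
  rw [map_smul, boundedGroup]

theorem star_boundedGroup {T : H →L[ℂ] H} (hT : IsSelfAdjoint T) (τ : ℝ) :
    star (boundedGroup T τ) = boundedGroup T (-τ) := by
  have h1 := Unitary.star_mul_self_of_mem (boundedGroup_mem_unitary hT τ)
  have h2 : boundedGroup T τ * boundedGroup T (-τ) = 1 := by
    rw [← boundedGroup_add, add_neg_cancel, boundedGroup_zero]
  calc _ = star (boundedGroup T τ) * (boundedGroup T τ * boundedGroup T (-τ)) := by rw [h2, mul_one]
    _ = _ := by rw [← mul_assoc, h1, one_mul]

/-- Commutation gives `e^{iτS} = e^{iτT} e^{iτ(S - T)}`, so only the orbit of `x` under the group of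
`S - T` matters, and its speed is constantly `‖(S - T) x‖`. -/
theorem norm_boundedGroup_sub_le {S T : H →L[ℂ] H} (hS : IsSelfAdjoint S) (hT : IsSelfAdjoint T)
    (h : Commute S T) (x : H) (τ : ℝ) :
    ‖boundedGroup S τ x - boundedGroup T τ x‖ ≤ |τ| * ‖S x - T x‖ := by
  have hd : ∀ σ : ℝ, HasDerivAt (fun σ => boundedGroup (S - T) σ x)
      (Complex.I • boundedGroup (S - T) σ ((S - T) x)) σ := hasDerivAt_boundedGroup _ x
  have h1 := Convex.norm_image_sub_le_of_norm_hasDerivWithin_le (C := ‖S x - T x‖)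
    (fun σ _ => (hd σ).hasDerivWithinAt) (fun σ _ => by
      rw [norm_smul, Complex.norm_I, one_mul, norm_boundedGroup_apply (hS.sub hT)]; rfl)
    convex_univ (Set.mem_univ 0) (Set.mem_univ τ)
  rw [boundedGroup_zero, sub_zero, Real.norm_eq_abs, mul_comm] at h1
  have h2 : boundedGroup S τ = boundedGroup T τ * boundedGroup (S - T) τ := by
    have : τ • (Complex.I • S) = τ • (Complex.I • T) + τ • (Complex.I • (S - T)) := by
      rw [← smul_add, ← smul_add, add_sub_cancel]
    rw [boundedGroup, this, NormedSpace.exp_add_of_commute_of_mem_ball (𝕂 := ℂ)]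
    · rfl
    · have h3 : Commute T (S - T) := h.symm.sub_right (Commute.refl T)
      exact (((h3.smul_left Complex.I).smul_right Complex.I).smul_left τ).smul_right τ
    all_goals rw [NormedSpace.expSeries_radius_eq_top]; exact edist_lt_top _ _
  rw [h2, mul_apply_eq_comp, ← map_sub, norm_boundedGroup_apply hT]
  exact h1

end Bounded

variable {H : Type*} [NormedAddCommGroup H] [InnerProductSpace ℂ H] [CompleteSpace H]
  {A : H →ₗ.[ℂ] H}

theorem exists_isUnitaryGroupOf (hA : IsSelfAdjoint A) :
    ∃ W : ℝ → H →L[ℂ] H, IsUnitaryGroupOf A W := by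
  obtain ⟨T, hT, hcomm, hlim⟩ := exists_approximation hA
  have hE : ∀ n τ x, ‖boundedGroup (T n) τ x‖ = ‖x‖ := fun n => norm_boundedGroup_apply (hT n)
  -- On a domain vector `y` the groups differ by at most `|τ| ‖T m y - T n y‖`; a general `x` is
  -- handled by density and unitarity.
  have hcauchy : ∀ (x : H) (r : ℝ), UniformCauchySeqOn
      (fun n τ => boundedGroup (T n) τ x) atTop (Metric.ball (0 : ℝ) r) := by
    intro x r
    rw [Metric.uniformCauchySeqOn_iff]
    intro ε hε
    obtain ⟨y, hy, hyD⟩ := Metric.dense_iff.mp hA.dense_domain x (ε / 3) (by positivity)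
    rw [Metric.mem_ball, dist_eq_norm] at hy
    obtain ⟨N, hN⟩ := Metric.cauchySeq_iff.mp (hlim ⟨y, hyD⟩).cauchySeq (ε / 3 / (|r| + 1))
      (by positivity)
    refine ⟨N, fun m hm n hn τ hτ => ?_⟩
    have h1 := hN m hm n hn
    simp only at h1
    rw [dist_eq_norm, lt_div_iff₀ (by positivity)] at h1
    have h2 := norm_boundedGroup_sub_le (hT m) (hT n) (hcomm m n) y τ
    have h3 : |τ| ≤ |r| + 1 := by
      rw [Metric.mem_ball, dist_zero_right, Real.norm_eq_abs] at hτ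
      linarith [le_abs_self r]
    have h4 : |τ| * ‖T m y - T n y‖ ≤ (|r| + 1) * ‖T m y - T n y‖ := by gcongr
    have h5 : boundedGroup (T m) τ x - boundedGroup (T n) τ x = -boundedGroup (T m) τ (y - x) +
      (boundedGroup (T m) τ y - boundedGroup (T n) τ y) + boundedGroup (T n) τ (y - x) := by
      rw [map_sub, map_sub]; abel
    rw [dist_eq_norm, h5]
    refine (norm_add₃_le).trans_lt ?_
    rw [norm_neg, hE, hE]
    linarith
  have hex : ∀ τ x, ∃ w, Tendsto (fun n => boundedGroup (T n) τ x) atTop (𝓝 w) := fun τ x =>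
    cauchySeq_tendsto_of_complete
      ((hcauchy x (|τ| + 1)).cauchySeq (by simp [Metric.mem_ball]))
  choose w hw using hex
  have hw' : ∀ τ, Tendsto (fun n x => boundedGroup (T n) τ x) atTop (𝓝 (w τ)) := fun τ =>
    tendsto_pi_nhds.mpr (hw τ)
  let W : ℝ → H →L[ℂ] H := fun τ => continuousLinearMapOfTendsto _ (hw' τ)
  have hW : ∀ τ x, Tendsto (fun n => boundedGroup (T n) τ x) atTop (𝓝 (W τ x)) := hw
  have hunif : ∀ x r, TendstoUniformlyOn (fun n τ => boundedGroup (T n) τ x) (fun τ => W τ x)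
      atTop (Metric.ball (0 : ℝ) r) := fun x r =>
    (hcauchy x r).tendstoUniformlyOn_of_tendsto fun τ _ => hW τ x
  have hWnorm : ∀ τ x, ‖W τ x‖ = ‖x‖ := fun τ x =>
    tendsto_nhds_unique (hW τ x).norm (by simp [hE])
  have hW0 : W 0 = 1 := by
    ext x
    exact tendsto_nhds_unique (hW 0 x) (by simp [boundedGroup_zero])
  have hWadd : ∀ σ τ, W (σ + τ) = W σ * W τ := by
    intro σ τ
    ext x
    refine tendsto_nhds_unique (hW _ x) ?_
    rw [tendsto_iff_norm_sub_tendsto_zero]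
    have h1 := (tendsto_iff_norm_sub_tendsto_zero.mp (hW τ x)).add
      (tendsto_iff_norm_sub_tendsto_zero.mp (hW σ (W τ x)))
    rw [add_zero] at h1
    refine squeeze_zero (fun n => norm_nonneg _) (fun n => ?_) h1
    rw [boundedGroup_add, mul_apply_eq_comp, mul_apply_eq_comp]
    refine (norm_sub_le_norm_sub_add_norm_sub _ (boundedGroup (T n) σ (W τ x)) _).trans ?_
    rw [← map_sub, hE]
  have hWstar : ∀ τ, star (W τ) = W (-τ) := by
    intro τ
    refine ContinuousLinearMap.ext fun y => ?_
    refine ext_inner_left ℂ fun x => ?_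
    rw [ContinuousLinearMap.star_eq_adjoint, ContinuousLinearMap.adjoint_inner_right]
    refine tendsto_nhds_unique ((hW τ x).inner tendsto_const_nhds) ?_
    have h1 : ∀ n, inner ℂ (boundedGroup (T n) τ x) y = inner ℂ x (boundedGroup (T n) (-τ) y) := by
      intro n
      rw [← star_boundedGroup (hT n), ContinuousLinearMap.star_eq_adjoint,
        ContinuousLinearMap.adjoint_inner_right]
    simp only [h1]
    exact tendsto_const_nhds.inner (hW (-τ) y)
  have hderiv : ∀ x : A.domain, HasDerivAt (fun τ => W τ x) (Complex.I • A x) 0 := by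
    intro x
    have h1 : HasDerivAt (fun τ => W τ x) ((fun τ => Complex.I • W τ (A x)) 0) 0 := by
      refine hasDerivAt_of_tendstoUniformlyOn (l := atTop) (s := Metric.ball (0 : ℝ) 1)
        (f := fun n τ => boundedGroup (T n) τ x) (g' := fun τ => Complex.I • W τ (A x))
        (f' := fun n τ => Complex.I • boundedGroup (T n) τ (T n x)) Metric.isOpen_ball ?_
        (Eventually.of_forall fun n τ _ => hasDerivAt_boundedGroup (T n) x τ)
        (fun τ _ => hW τ x) (Metric.mem_ball_self one_pos)
      rw [Metric.tendstoUniformlyOn_iff]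
      intro ε hε
      filter_upwards [Metric.tendstoUniformlyOn_iff.mp (hunif (A x) 1) (ε / 2) (by positivity),
        (Metric.tendsto_nhds.mp (hlim x)) (ε / 2) (by positivity)] with n h1 h2 τ hτ
      have h3 := h1 τ hτ
      rw [dist_eq_norm] at h2 h3 ⊢
      rw [← smul_sub, norm_smul, Complex.norm_I, one_mul]
      refine (norm_sub_le_norm_sub_add_norm_sub _ (boundedGroup (T n) τ (A x)) _).trans_lt ?_
      rw [← map_sub, hE, norm_sub_rev (A x)]
      linarith
    simpa [hW0] using h1
  refine ⟨W, fun τ => ?_, hW0, hWadd, fun x => ?_, fun x φ => ⟨fun h => ?_, ?_⟩⟩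
  · rw [Unitary.mem_iff, hWstar, ← hWadd, ← hWadd]
    simp [hW0]
  · rw [continuous_iff_continuousAt]
    intro τ
    have h1 : ContinuousOn (fun τ => W τ x) (Metric.ball (0 : ℝ) (|τ| + 1)) :=
      (hunif x _).continuousOn (Frequently.of_forall fun n =>
        continuousOn_of_forall_continuousAt fun σ _ =>
          (hasDerivAt_boundedGroup (T n) x σ).continuousAt)
    exact h1.continuousAt (Metric.isOpen_ball.mem_nhds (by simp))
  -- The generator is no larger than `i A`: differentiating the constant `⟪W τ x, W τ y⟫` at `0`,
  -- for `y` in the domain, shows that `x` is in the domain of the adjoint.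
  · have h1 : ∀ y : A.domain, inner ℂ (-Complex.I • φ) (y : H) = inner ℂ x (A y) := by
      intro y
      have h2 := h.inner ℂ (hderiv y)
      have h3 : (fun τ => inner ℂ (W τ x) (W τ y)) = fun _ => inner ℂ x (y : H) := by
        ext τ
        rw [← ContinuousLinearMap.adjoint_inner_right, ← ContinuousLinearMap.star_eq_adjoint,
          hWstar, ← mul_apply_eq_comp, ← hWadd]
        simp [hW0]
      rw [h3] at h2
      have h4 := h2.unique (hasDerivAt_const _ _)
      rw [hW0, inner_smul_right, one_apply_eq_self, one_apply_eq_self] at h4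
      rw [inner_smul_left]
      simp only [map_neg, Complex.conj_I, neg_neg]
      linear_combination Complex.I * h4 - inner ℂ x (A y) * Complex.I_sq
    obtain ⟨hx, hAx⟩ := mem_domain_of_inner hA h1
    refine ⟨hx, ?_⟩
    rw [hAx, smul_smul]; simp
  · rintro ⟨hx, rfl⟩
    exact hderiv ⟨x, hx⟩

end SelfAdjointGroup

theorem isUnitaryGroupOf_expI {H : Type*} [NormedAddCommGroup H] [InnerProductSpace ℂ H]
    [CompleteSpace H] {A : H →ₗ.[ℂ] H} (hA : IsSelfAdjoint A) : IsUnitaryGroupOf A (expI A) := by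
  have h := SelfAdjointGroup.exists_isUnitaryGroupOf hA
  have h2 : expI A = h.choose := by
    ext τ
    rw [expI, dif_pos h]
  rw [h2]
  exact h.choose_spec

/-! ### Approximate solutions and the energy estimate. -/

theorem norm_sub_le_of_norm_deriv_right_le {F : Type*} [NormedAddCommGroup F] [NormedSpace ℝ F]
    {f f' : ℝ → F} {p q C : ℝ} (hf : ContinuousOn f (Icc p q))
    (hf' : ∀ x ∈ Ico p q, HasDerivWithinAt f (f' x) (Ici x) x) (bound : ∀ x ∈ Ico p q, ‖f' x‖ ≤ C)
    {s t : ℝ} (hs : s ∈ Icc p q) (ht : t ∈ Icc p q) : ‖f t - f s‖ ≤ C * |t - s| := by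
  have key : ∀ s ∈ Icc p q, ∀ t ∈ Icc p q, s ≤ t → ‖f t - f s‖ ≤ C * |t - s| := by
    intro s hs t ht hst
    rw [abs_of_nonneg (sub_nonneg.mpr hst)]
    exact norm_image_sub_le_of_norm_deriv_right_le_segment
      (hf.mono (Icc_subset_Icc hs.1 ht.2)) (fun x hx => hf' x ⟨hs.1.trans hx.1, hx.2.trans_le ht.2⟩)
      (fun x hx => bound x ⟨hs.1.trans hx.1, hx.2.trans_le ht.2⟩) t ⟨hst, le_rfl⟩
  rcases le_total s t with h | h
  · exact key s hs t ht h
  · rw [norm_sub_rev, abs_sub_comm]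
    exact key t ht s hs h

namespace Evolution

variable {E H : Type*} [NormedAddCommGroup E] [InnerProductSpace ℂ E] [CompleteSpace E]
  [NormedAddCommGroup H] [InnerProductSpace ℂ H] [CompleteSpace H]

/-- The Gram operator `ι* ι`: it represents the inner product of `H` on `E`. -/
noncomputable def gram (ι : E →L[ℂ] H) : E →L[ℂ] E := (ContinuousLinearMap.adjoint ι).comp ι

theorem gram_apply (ι : E →L[ℂ] H) (x : E) :
    gram ι x = ContinuousLinearMap.adjoint ι (ι x) := rfl

theorem inner_gram (ι : E →L[ℂ] H) (x y : E) : inner ℂ x (gram ι y) = inner ℂ (ι x) (ι y) := by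
  rw [gram_apply, ContinuousLinearMap.adjoint_inner_right]

theorem inner_gram_left (ι : E →L[ℂ] H) (x y : E) :
    inner ℂ (gram ι x) y = inner ℂ (ι x) (ι y) := by
  rw [gram_apply, ContinuousLinearMap.adjoint_inner_left]

/-- No derivative of `w` in `E` is needed: the slope of `‖ι w‖²` is exactly the real part of the
inner product of `w τ + w t` with the slope of `gram ι w`, so continuity of `w` is enough. -/
theorem hasDerivWithinAt_norm_sq (ι : E →L[ℂ] H) {w : ℝ → E} {D : E} {s : Set ℝ} {t : ℝ}
    (hw : ContinuousWithinAt w s t) (hd : HasDerivWithinAt (fun τ => gram ι (w τ)) D s t) :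
    HasDerivWithinAt (fun τ => ‖ι (w τ)‖ ^ 2) (2 * (inner ℂ (w t) D).re) s t := by
  rw [hasDerivWithinAt_iff_tendsto_slope] at hd ⊢
  have h1 : Tendsto (fun τ => w τ + w t) (𝓝[s \ {t}] t) (𝓝 (w t + w t)) :=
    (hw.mono sdiff_subset).add tendsto_const_nhds
  have h2 := (Complex.continuous_re.tendsto _).comp (h1.inner (𝕜 := ℂ) hd)
  have h3 : (inner ℂ (w t + w t) D).re = 2 * (inner ℂ (w t) D).re := by
    rw [inner_add_left, Complex.add_re]; ring
  rw [h3] at h2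
  refine h2.congr fun τ => ?_
  simp only [Function.comp_apply, slope, vsub_eq_sub]
  rw [inner_smul_right_eq_smul, Complex.smul_re, inner_sub_right, inner_add_left, inner_add_left]
  simp only [inner_gram]
  congr 1
  have h4 : (inner ℂ (ι (w t)) (ι (w τ))).re = (inner ℂ (ι (w τ)) (ι (w t))).re :=
    inner_re_symm (𝕜 := ℂ) _ _
  have h5 : ∀ x : H, (inner ℂ x x).re = ‖x‖ ^ 2 := inner_self_eq_norm_sq (𝕜 := ℂ)
  simp only [Complex.sub_re, Complex.add_re, h4, h5]
  ring

/-- A continuous solution `u`, on `[p, q]`, of `i ∂ₜ ι*ι u = T(t) u`, where the operators `T(t)` are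
symmetric and `ε`-close to `B(t)`. Right derivatives suffice. -/
structure IsApproxSol (ι : E →L[ℂ] H) (B : ℝ → E →L[ℂ] E) (ε p q : ℝ) (u : ℝ → E) : Prop where
  continuousOn : ContinuousOn u (Icc p q)
  deriv : ∀ t ∈ Ico p q, ∃ T : E →L[ℂ] E, (∀ f, (inner ℂ f (T f)).im = 0) ∧ ‖T - B t‖ ≤ ε ∧
    HasDerivWithinAt (fun τ => gram ι (u τ)) (-Complex.I • T (u t)) (Ici t) t

namespace IsApproxSol

variable {ι : E →L[ℂ] H} {B : ℝ → E →L[ℂ] E} {ε ε₁ ε₂ p q r M L : ℝ} {u u₁ u₂ : ℝ → E}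

theorem mono (h : IsApproxSol ι B ε p q u) {p' q' : ℝ} (hp : p ≤ p') (hq : q' ≤ q) :
    IsApproxSol ι B ε p' q' u :=
  ⟨h.continuousOn.mono (Icc_subset_Icc hp hq), fun t ht =>
    h.deriv t ⟨hp.trans ht.1, ht.2.trans_le hq⟩⟩

/-- With `w = u₁ - u₂`, the derivative of `gram ι w` is `-i T₁ w - i (T₁ - T₂) u₂`. The first term
contributes nothing by symmetry, and in the second `T₁ - T₂` has norm at most `ε₁ + ε₂`. The
constant is `2 * (2 * M) * ((ε₁ + ε₂) * M)`. -/
theorem norm_sq_sub_le (h₁ : IsApproxSol ι B ε₁ p q u₁) (h₂ : IsApproxSol ι B ε₂ p q u₂)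
    (hM₁ : ∀ t ∈ Icc p q, ‖u₁ t‖ ≤ M) (hM₂ : ∀ t ∈ Icc p q, ‖u₂ t‖ ≤ M)
    {s t : ℝ} (hs : s ∈ Icc p q) (ht : t ∈ Icc p q) :
    |‖ι (u₁ t - u₂ t)‖ ^ 2 - ‖ι (u₁ s - u₂ s)‖ ^ 2| ≤ 4 * M ^ 2 * (ε₁ + ε₂) * |t - s| := by
  choose! T₁ hT₁ hT₁' hd₁ using h₁.deriv
  choose! T₂ hT₂ hT₂' hd₂ using h₂.deriv
  have hc := h₁.continuousOn.sub h₂.continuousOn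
  have hM : 0 ≤ M := (norm_nonneg _).trans (hM₁ s hs)
  refine norm_sub_le_of_norm_deriv_right_le (f := fun t => ‖ι (u₁ t - u₂ t)‖ ^ 2)
    (f' := fun x => 2 * (inner ℂ (u₁ x - u₂ x)
      (-Complex.I • T₁ x (u₁ x) - -Complex.I • T₂ x (u₂ x))).re)
    (((ι.continuous.comp_continuousOn hc).norm).pow 2) (fun x hx => ?_) (fun x hx => ?_) hs ht
  · refine hasDerivWithinAt_norm_sq ι (w := fun τ => u₁ τ - u₂ τ) ?_ ?_
    · exact (hc x ⟨hx.1, hx.2.le⟩).mono_of_mem_nhdsWithin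
        (mem_of_superset (Icc_mem_nhdsGE hx.2) (Icc_subset_Icc hx.1 le_rfl))
    · simp only [map_sub]
      exact (hd₁ x hx).sub (hd₂ x hx)
  · have hx' : x ∈ Icc p q := ⟨hx.1, hx.2.le⟩
    set w := u₁ x - u₂ x with hw
    have h1 : -Complex.I • T₁ x (u₁ x) - -Complex.I • T₂ x (u₂ x) =
        -Complex.I • T₁ x w + -Complex.I • ((T₁ x - B x) - (T₂ x - B x)) (u₂ x) := by
      simp only [hw, map_sub, sub_apply]; module
    have h2 : (inner ℂ w (-Complex.I • T₁ x w)).re = 0 := by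
      rw [inner_smul_right]; simp [hT₁ x hx w]
    have h3 : ‖((T₁ x - B x) - (T₂ x - B x)) (u₂ x)‖ ≤ (ε₁ + ε₂) * M := by
      refine (ContinuousLinearMap.le_opNorm _ _).trans ?_
      have := (norm_sub_le (T₁ x - B x) (T₂ x - B x)).trans (add_le_add (hT₁' x hx) (hT₂' x hx))
      exact mul_le_mul this (hM₂ x hx') (norm_nonneg _) ((norm_nonneg _).trans this)
    have h4 : ‖w‖ ≤ 2 * M := by
      have := norm_sub_le (u₁ x) (u₂ x)
      linarith [hM₁ x hx', hM₂ x hx']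
    rw [h1, inner_add_right, Complex.add_re, h2, zero_add, Real.norm_eq_abs, abs_mul, abs_two]
    have h5 : |(inner ℂ w (-Complex.I • ((T₁ x - B x) - (T₂ x - B x)) (u₂ x))).re| ≤
        (2 * M) * ((ε₁ + ε₂) * M) := by
      refine (Complex.abs_re_le_norm _).trans ((norm_inner_le_norm _ _).trans ?_)
      rw [norm_smul, norm_neg, Complex.norm_I, one_mul]
      exact mul_le_mul h4 h3 (norm_nonneg _) (by positivity)
    linarith

theorem norm_gram_sub_le (h : IsApproxSol ι B ε p q u) (hM : ∀ t ∈ Icc p q, ‖u t‖ ≤ M)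
    (hL : ∀ t ∈ Icc p q, ‖B t‖ ≤ L) {s t : ℝ} (hs : s ∈ Icc p q) (ht : t ∈ Icc p q) :
    ‖gram ι (u t) - gram ι (u s)‖ ≤ (ε + L) * M * |t - s| := by
  choose! T hT hT' hd using h.deriv
  refine norm_sub_le_of_norm_deriv_right_le
    ((gram ι).continuous.comp_continuousOn h.continuousOn) hd (fun x hx => ?_) hs ht
  rw [norm_smul, norm_neg, Complex.norm_I, one_mul]
  refine (ContinuousLinearMap.le_opNorm _ _).trans ?_
  have h1 : ‖T x‖ ≤ ε + L := by
    have h2 := norm_add_le (T x - B x) (B x)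
    rw [sub_add_cancel] at h2
    linarith [hT' x hx, hL x ⟨hx.1, hx.2.le⟩]
  exact mul_le_mul h1 (hM x ⟨hx.1, hx.2.le⟩) (norm_nonneg _) ((norm_nonneg _).trans h1)

/-- If the operators stay close to `B s` and `u` stays close to `u s`, then `ι*ι u` is close to its
first order expansion at `s`. -/
theorem norm_gram_sub_add_le (h : IsApproxSol ι B ε p q u) (hM : ∀ t ∈ Icc p q, ‖u t‖ ≤ M)
    {s t η κ : ℝ} (hs : s ∈ Icc p q) (ht : t ∈ Icc p q)
    (hB : ∀ t ∈ Icc p q, ‖B t - B s‖ ≤ η) (hu : ∀ t ∈ Icc p q, ‖u t - u s‖ ≤ κ) :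
    ‖gram ι (u t) - gram ι (u s) - (t - s) • (-Complex.I • B s (u s))‖ ≤
      ((ε + η) * M + ‖B s‖ * κ) * |t - s| := by
  choose! T hT hT' hd using h.deriv
  -- Subtracting the linear part reduces the claim to a bound on the derivative `-i (T t (u t) - B s
  -- (u s))`.
  have h1 := norm_sub_le_of_norm_deriv_right_le
    (f := fun t => gram ι (u t) - t • (-Complex.I • B s (u s)))
    (f' := fun t => -Complex.I • T t (u t) - -Complex.I • B s (u s)) (C := (ε + η) * M + ‖B s‖ * κ)
    (((gram ι).continuous.comp_continuousOn h.continuousOn).sub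
      (continuous_id.smul continuous_const).continuousOn)
    (fun x hx => (hd x hx).sub (by
      simpa using ((hasDerivAt_id x).smul_const (-Complex.I • B s (u s))).hasDerivWithinAt))
    (fun x hx => ?_) hs ht
  · refine le_trans (le_of_eq ?_) h1
    congr 1
    module
  · have hx' : x ∈ Icc p q := ⟨hx.1, hx.2.le⟩
    rw [← smul_sub, norm_smul, norm_neg, Complex.norm_I, one_mul]
    have h2 : T x (u x) - B s (u s) = ((T x - B x) + (B x - B s)) (u x) + B s (u x - u s) := by
      simp only [add_apply, sub_apply, map_sub]; abel
    rw [h2]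
    refine (norm_add_le _ _).trans (add_le_add ?_ ?_)
    · refine (ContinuousLinearMap.le_opNorm _ _).trans ?_
      have h3 := (norm_add_le (T x - B x) (B x - B s)).trans (add_le_add (hT' x hx) (hB x hx'))
      exact mul_le_mul h3 (hM x hx') (norm_nonneg _) ((norm_nonneg _).trans h3)
    · exact (ContinuousLinearMap.le_opNorm _ _).trans
        (mul_le_mul_of_nonneg_left (hu x hx') (norm_nonneg _))

/-- This is why only right derivatives are required: at the node `q` the second piece alone decides,
and matching values suffice. -/
theorem glue (h₁ : IsApproxSol ι B ε p q u₁) (h₂ : IsApproxSol ι B ε q r u₂) (hq : u₁ q = u₂ q) :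
    IsApproxSol ι B ε p r (fun t => if t ≤ q then u₁ t else u₂ t) := by
  have hR : ∀ t, q ≤ t → (if t ≤ q then u₁ t else u₂ t) = u₂ t := by
    intro t ht
    split_ifs with h
    · rw [le_antisymm h ht, hq]
    · rfl
  refine ⟨?_, fun t ht => ?_⟩
  · have h3 : ContinuousOn (fun t => if t ≤ q then u₁ t else u₂ t) (Icc p q ∪ Icc q r) := by
      refine ContinuousOn.union_of_isClosed ?_ ?_ isClosed_Icc isClosed_Icc
      · exact h₁.continuousOn.congr fun t ht => if_pos ht.2
      · exact h₂.continuousOn.congr fun t ht => hR t ht.1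
    refine h3.mono fun t ht => ?_
    rcases le_total t q with h | h
    · exact Or.inl ⟨ht.1, h⟩
    · exact Or.inr ⟨h, ht.2⟩
  · rcases lt_or_ge t q with h | h
    · obtain ⟨T, hT, hT', hd⟩ := h₁.deriv t ⟨ht.1, h⟩
      refine ⟨T, hT, hT', ?_⟩
      simp only [if_pos h.le]
      refine hd.congr_of_eventuallyEq ?_ (by simp only [if_pos h.le])
      filter_upwards [mem_nhdsWithin_of_mem_nhds (Iio_mem_nhds h)] with x hx
      simp only [if_pos (le_of_lt (mem_Iio.mp hx))]
    · obtain ⟨T, hT, hT', hd⟩ := h₂.deriv t ⟨h, ht.2⟩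
      refine ⟨T, hT, hT', ?_⟩
      simp only [hR t h]
      exact hd.congr (fun x hx => by simp only [hR x (h.trans hx)]) (by simp only [hR t h])

end IsApproxSol

/-- A norm continuous family `B` of symmetric operators, with frozen groups `G` which satisfy the
stability condition for the Hilbertian norms `N`. -/
structure IsStableFamily (ι : E →L[ℂ] H) (a b c : ℝ) (B : ℝ → E →L[ℂ] E) (G : ℝ → ℝ → E →L[ℂ] E)
    (N : ℝ → E → ℝ) : Prop where
  injective : Function.Injective ι
  le : a ≤ b
  continuousOn : ContinuousOn B (Icc a b)
  symm : ∀ t ∈ Icc a b, ∀ f, (inner ℂ f (B t f)).im = 0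
  zero : ∀ t ∈ Icc a b, G t 0 = 1
  continuous : ∀ t ∈ Icc a b, ∀ v, Continuous fun τ => G t τ v
  deriv : ∀ t ∈ Icc a b, ∀ v τ,
    HasDerivAt (fun τ => gram ι (G t τ v)) (Complex.I • B t (G t τ v)) τ
  hilbertian : ∀ t ∈ Icc a b, IsHilbertianNorm (N t)
  equivalent : ∀ t ∈ Icc a b, IsEquivalentNorm (N t)
  pos : 0 < c
  lip : ∀ t ∈ Icc a b, ∀ s ∈ Icc a b, ∀ v, N t v ≤ Real.exp (c * |t - s|) * N s v
  growth : ∀ t ∈ Icc a b, ∀ τ v, N t (G t τ v) ≤ Real.exp (c * |τ|) * N t v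

/-! ### Piecewise frozen evolutions and mesh-independent bounds. -/

namespace IsStableFamily

variable {ι : E →L[ℂ] H} {a b c : ℝ} {B : ℝ → E →L[ℂ] E} {G : ℝ → ℝ → E →L[ℂ] E}
  {N : ℝ → E → ℝ}

/-- Since `G t₀ τ` plays the role of `e^{iτA(t₀)}`, the Schrödinger evolution from `t₀` is `G t₀ (t₀
- t)`, on either side of `t₀`. -/
theorem isApproxSol_frozen (F : IsStableFamily ι a b c B G N) {t₀ p q ε : ℝ} (ht₀ : t₀ ∈ Icc a b)
    (v : E) (hε : ∀ t ∈ Icc p q, ‖B t₀ - B t‖ ≤ ε) :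
    IsApproxSol ι B ε p q (fun t => G t₀ (t₀ - t) v) := by
  refine ⟨((F.continuous t₀ ht₀ v).comp (continuous_const.sub continuous_id)).continuousOn,
    fun t ht => ⟨B t₀, F.symm t₀ ht₀, hε t ⟨ht.1, ht.2.le⟩, ?_⟩⟩
  have h := (F.deriv t₀ ht₀ v (t₀ - t)).comp_const_sub t₀ t
  rw [← neg_smul] at h
  exact h.hasDerivWithinAt

/-- One factor `e^{c|t - t₀|}` comes from the frozen group, a second from passing from `N t₀` to `N
t`. The hypothesis `h` expresses that `t₀` lies between `s` and `t`, so that exponents add up along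
successive steps. -/
theorem norm_frozen_le (F : IsStableFamily ι a b c B G N) {s t₀ t : ℝ} (ht₀ : t₀ ∈ Icc a b)
    (ht : t ∈ Icc a b) {v : E} {m : ℝ} (hv : N t₀ v ≤ Real.exp (2 * c * |t₀ - s|) * m)
    (h : |t - s| = |t - t₀| + |t₀ - s|) :
    N t (G t₀ (t₀ - t) v) ≤ Real.exp (2 * c * |t - s|) * m := by
  calc _ ≤ Real.exp (c * |t - t₀|) * (Real.exp (c * |t₀ - t|) *
        (Real.exp (2 * c * |t₀ - s|) * m)) := by
        refine (F.lip t ht t₀ ht₀ _).trans ?_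
        gcongr
        refine (F.growth t₀ ht₀ _ _).trans ?_
        gcongr
    _ = _ := by
        rw [h, abs_sub_comm t₀ t, ← mul_assoc, ← mul_assoc, ← Real.exp_add, ← Real.exp_add]
        ring_nf

theorem exists_isApproxSol (F : IsStableFamily ι a b c B G N) {ε s : ℝ} (hε : 0 < ε)
    (hs : s ∈ Icc a b) (ψ : E) :
    ∃ u, IsApproxSol ι B ε a b u ∧ u s = ψ ∧
      ∀ t ∈ Icc a b, N t (u t) ≤ Real.exp (2 * c * |t - s|) * N s ψ := by
  obtain ⟨δ, hδ, hBδ⟩ := Metric.uniformContinuousOn_iff_le.mp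
    (isCompact_Icc.uniformContinuousOn_of_continuous F.continuousOn) ε hε
  simp only [dist_eq_norm, Real.norm_eq_abs] at hBδ
  -- Steps of length at most `δ`, each frozen at its end nearer to `s`. Truncation by `min b` lets
  -- the induction run for all `k` without leaving the interval; for `k = 0` the interval is a
  -- point.
  have hforward : ∀ k : ℕ, ∃ u, IsApproxSol ι B ε s (min b (s + k * δ)) u ∧ u s = ψ ∧
      ∀ t ∈ Icc s (min b (s + k * δ)), N t (u t) ≤ Real.exp (2 * c * |t - s|) * N s ψ := by
    intro k
    induction k with
    | zero =>
      refine ⟨fun _ => ψ, ⟨continuousOn_const, fun t ht => ?_⟩, rfl, fun t ht => ?_⟩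
      · have := ht.1.trans_lt (ht.2.trans_le (min_le_right _ _))
        simp at this
      · have : t = s := le_antisymm (by simpa using ht.2.trans (min_le_right _ _)) ht.1
        simp [this]
    | succ k ih =>
      obtain ⟨u, hu, hus, hN⟩ := ih
      set t₀ := min b (s + k * δ) with ht₀
      have hst₀ : s ≤ t₀ := le_min hs.2 (by nlinarith [k.cast_nonneg (α := ℝ)])
      have ht₀I : t₀ ∈ Icc a b := ⟨hs.1.trans hst₀, min_le_left _ _⟩
      have hstep : ∀ t ∈ Icc t₀ (min b (s + (k + 1 : ℕ) * δ)), t ∈ Icc a b ∧ |t₀ - t| ≤ δ := by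
        intro t ht
        have h1 := ht.2.trans (min_le_left _ _)
        have h2 := ht.2.trans (min_le_right _ _)
        refine ⟨⟨ht₀I.1.trans ht.1, h1⟩, ?_⟩
        rw [abs_sub_comm, abs_of_nonneg (sub_nonneg.mpr ht.1)]
        push_cast at h2
        rcases min_choice b (s + k * δ) with h | h <;> rw [← ht₀] at h <;> linarith
      have h2 := F.isApproxSol_frozen ht₀I (u t₀) fun t ht =>
        hBδ t₀ ht₀I t (hstep t ht).1 (hstep t ht).2
      refine ⟨_, hu.glue h2 (by simp [F.zero t₀ ht₀I]), by simp [hst₀, hus], fun t ht => ?_⟩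
      rcases le_or_gt t t₀ with h | h
      · simp only [if_pos h]
        exact hN t ⟨ht.1, h⟩
      · simp only [if_neg h.not_ge]
        refine F.norm_frozen_le ht₀I (hstep t ⟨h.le, ht.2⟩).1 (hN t₀ ⟨hst₀, le_rfl⟩) ?_
        rw [abs_of_nonneg, abs_of_nonneg, abs_of_nonneg] <;> linarith
  have hbackward : ∀ k : ℕ, ∃ u, IsApproxSol ι B ε (max a (s - k * δ)) s u ∧ u s = ψ ∧
      ∀ t ∈ Icc (max a (s - k * δ)) s, N t (u t) ≤ Real.exp (2 * c * |t - s|) * N s ψ := by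
    intro k
    induction k with
    | zero =>
      refine ⟨fun _ => ψ, ⟨continuousOn_const, fun t ht => ?_⟩, rfl, fun t ht => ?_⟩
      · have := ((le_max_right _ _).trans ht.1).trans_lt ht.2
        simp at this
      · have : t = s := le_antisymm ht.2 (by simpa using (le_max_right _ _).trans ht.1)
        simp [this]
    | succ k ih =>
      obtain ⟨u, hu, hus, hN⟩ := ih
      set t₀ := max a (s - k * δ) with ht₀
      have hst₀ : t₀ ≤ s := max_le hs.1 (by nlinarith [k.cast_nonneg (α := ℝ)])
      have ht₀I : t₀ ∈ Icc a b := ⟨le_max_left _ _, hst₀.trans hs.2⟩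
      have hstep : ∀ t ∈ Icc (max a (s - (k + 1 : ℕ) * δ)) t₀, t ∈ Icc a b ∧ |t₀ - t| ≤ δ := by
        intro t ht
        have h1 := (le_max_left _ _).trans ht.1
        have h2 := (le_max_right _ _).trans ht.1
        refine ⟨⟨h1, ht.2.trans ht₀I.2⟩, ?_⟩
        rw [abs_of_nonneg (sub_nonneg.mpr ht.2)]
        push_cast at h2
        rcases max_choice a (s - k * δ) with h | h <;> rw [← ht₀] at h <;> linarith
      have h2 := F.isApproxSol_frozen ht₀I (u t₀) fun t ht =>
        hBδ t₀ ht₀I t (hstep t ht).1 (hstep t ht).2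
      refine ⟨_, h2.glue hu (by simp [F.zero t₀ ht₀I]), ?_, fun t ht => ?_⟩
      -- Gluing assigns the node to the left piece, so the value at `s` is read off the new frozen
      -- piece precisely when `t₀ = s`.
      · rcases hst₀.eq_or_lt with h | h
        · rw [if_pos h.ge, ← h, sub_self, F.zero t₀ ht₀I, h]
          simpa using hus
        · rw [if_neg h.not_ge, hus]
      · rcases le_or_gt t t₀ with h | h
        · simp only [if_pos h]
          refine F.norm_frozen_le ht₀I (hstep t ⟨ht.1, h⟩).1 (hN t₀ ⟨le_rfl, hst₀⟩) ?_
          rw [abs_of_nonpos, abs_of_nonpos, abs_of_nonpos] <;> linarith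
        · simp only [if_neg h.not_ge]
          exact hN t ⟨h.le, ht.2⟩
  obtain ⟨k, hk⟩ := exists_nat_ge ((b - a) / δ)
  rw [div_le_iff₀ hδ] at hk
  obtain ⟨u₁, hu₁, hs₁, hN₁⟩ := hbackward k
  obtain ⟨u₂, hu₂, hs₂, hN₂⟩ := hforward k
  rw [max_eq_left (by linarith [hs.2])] at hu₁ hN₁
  rw [min_eq_left (by linarith [hs.1])] at hu₂ hN₂
  refine ⟨_, hu₁.glue hu₂ (hs₁.trans hs₂.symm), by simp [hs₁], fun t ht => ?_⟩
  rcases le_or_gt t s with h | h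
  · simp only [if_pos h]
    exact hN₁ t ⟨ht.1, h⟩
  · simp only [if_neg h.not_ge]
    exact hN₂ t ⟨h.le, ht.2⟩

/-- The norms are all compared with `N a`, at a cost of at most `e^{c(b - a)}`, which makes the
equivalence uniform in `t`. -/
theorem exists_norm_equivalence (F : IsStableFamily ι a b c B G N) :
    ∃ C : ℝ, 0 < C ∧ ∀ t ∈ Icc a b, ∀ v, N t v ≤ C * ‖v‖ ∧ ‖v‖ ≤ C * N t v := by
  have ha : a ∈ Icc a b := ⟨le_rfl, F.le⟩
  obtain ⟨C, hC, h⟩ := F.equivalent a ha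
  refine ⟨C * Real.exp (c * (b - a)), by positivity, fun t ht v => ?_⟩
  have h1 : Real.exp (c * |t - a|) ≤ Real.exp (c * (b - a)) := by
    rw [abs_of_nonneg (sub_nonneg.mpr ht.1)]
    have := F.pos
    gcongr
    exact ht.2
  have h0 : ∀ s ∈ Icc a b, 0 ≤ N s v := by
    intro s hs
    obtain ⟨core, hcore⟩ := F.hilbertian s hs
    rw [hcore]; positivity
  constructor
  · calc _ ≤ Real.exp (c * |t - a|) * N a v := F.lip t ht a ha v
      _ ≤ Real.exp (c * (b - a)) * (C * ‖v‖) := mul_le_mul h1 (h v).1 (h0 a ha) (by positivity)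
      _ = _ := by ring
  · calc _ ≤ C * N a v := (h v).2
      _ ≤ C * (Real.exp (c * (b - a)) * N t v) := by
        gcongr
        refine (F.lip a ha t ht v).trans ?_
        rw [abs_sub_comm]
        exact mul_le_mul_of_nonneg_right h1 (h0 t ht)
      _ = _ := by ring

theorem exists_norm_le (F : IsStableFamily ι a b c B G N) :
    ∃ C : ℝ, 0 ≤ C ∧ ∀ s ∈ Icc a b, ∀ t ∈ Icc a b, ∀ v w,
      N t w ≤ Real.exp (2 * c * |t - s|) * N s v → ‖w‖ ≤ C * ‖v‖ := by
  obtain ⟨C, hC, h⟩ := F.exists_norm_equivalence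
  refine ⟨C * (Real.exp (2 * c * (b - a)) * C), by positivity, fun s hs t ht v w hvw => ?_⟩
  have h1 : |t - s| ≤ b - a := by
    rw [abs_le]; constructor <;> linarith [hs.1, hs.2, ht.1, ht.2]
  have := F.pos
  calc _ ≤ C * N t w := (h t ht w).2
    _ ≤ C * (Real.exp (2 * c * (b - a)) * (C * ‖v‖)) := by
      gcongr
      refine hvw.trans (mul_le_mul ?_ (h s hs v).1 ?_ (by positivity))
      · gcongr
      · obtain ⟨core, hcore⟩ := F.hilbertian s hs
        rw [hcore]; positivity
    _ = _ := by ring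

end IsStableFamily

end Evolution

/-! ### Equivalent Hilbertian norms and weak lower semicontinuity. -/

theorem InnerProductSpace.Core.inner_facts {E : Type*} [AddCommGroup E] [Module ℂ E]
    (core : InnerProductSpace.Core ℂ E) :
    (∀ u v w, core.inner u (v + w) = core.inner u v + core.inner u w) ∧
    (∀ (r : ℂ) u v, core.inner u (r • v) = r * core.inner u v) ∧
    (∀ u v, ‖core.inner u v‖ ≤ √(core.inner u u).re * √(core.inner v v).re) ∧
    (∀ u v, √(core.inner (v - u) (v - u)).re ^ 2 = √(core.inner v v).re ^ 2 -
      √(core.inner u u).re ^ 2 - 2 * (core.inner u (v - u)).re) := by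
  -- Here `E` is a bare module, so the norm of `core` can be made an instance without clashing with
  -- another norm.
  let i1 : NormedAddCommGroup E := core.toNormedAddCommGroup
  let i2 : InnerProductSpace ℂ E := InnerProductSpace.ofCore core.toCore
  have hn : ∀ u : E, ‖u‖ = √(core.inner u u).re := fun _ => rfl
  refine ⟨fun u v w => inner_add_right (𝕜 := ℂ) u v w, fun r u v => _root_.inner_smul_right u v r,
    fun u v => ?_, fun u v => ?_⟩
  · rw [← hn, ← hn]
    exact norm_inner_le_norm (𝕜 := ℂ) u v
  · rw [← hn, ← hn, ← hn]
    have h1 := @norm_sub_sq ℂ E _ _ _ v u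
    have h2 : (core.inner u (v - u)).re = RCLike.re (inner ℂ v u) - ‖u‖ ^ 2 := by
      change RCLike.re (inner ℂ u (v - u)) = _
      rw [inner_sub_right, map_sub, inner_self_eq_norm_sq, inner_re_symm]
    rw [h1, h2]; ring

theorem IsHilbertianNorm.nonneg {E : Type*} [AddCommGroup E] [Module ℂ E] {n : E → ℝ}
    (hn : IsHilbertianNorm n) (u : E) : 0 ≤ n u := by
  obtain ⟨core, h⟩ := hn
  rw [h]; positivity

/-- The inner product of an equivalent Hilbertian norm `n` is `⟪S u, v⟫` for some map `S`. -/
theorem IsHilbertianNorm.exists_representation {E : Type*} [NormedAddCommGroup E]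
    [InnerProductSpace ℂ E] [CompleteSpace E] {n : E → ℝ} (hn : IsHilbertianNorm n)
    (he : IsEquivalentNorm n) :
    ∃ S : E → E, (∀ u v, ‖inner ℂ (S u) v‖ ≤ n u * n v) ∧
      (∀ u, (inner ℂ (S u) u).re = n u ^ 2) ∧
      ∀ u v, n (v - u) ^ 2 = n v ^ 2 - n u ^ 2 - 2 * (inner ℂ (S u) (v - u)).re := by
  obtain ⟨core, hcore⟩ := hn
  obtain ⟨C, hC, hCn⟩ := he
  obtain ⟨hadd, hsmul, hcs, hsub⟩ := core.inner_facts
  simp only [← hcore] at hcs hsub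
  have hself : ∀ u, (core.inner u u).re = n u ^ 2 := fun u => by
    rw [hcore]; exact (Real.sq_sqrt (core.re_inner_nonneg u)).symm
  have hn0 : ∀ u, 0 ≤ n u := fun u => by rw [hcore]; positivity
  let φ : E → E →L[ℂ] ℂ := fun u =>
    LinearMap.mkContinuous ⟨⟨core.inner u, hadd u⟩, fun r v => hsmul r u v⟩ (n u * C) fun v =>
      (hcs u v).trans (by
        rw [mul_assoc]
        exact mul_le_mul_of_nonneg_left (hCn v).1 (hn0 u))
  have hφ : ∀ u v, inner ℂ ((InnerProductSpace.toDual ℂ E).symm (φ u)) v = core.inner u v :=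
    fun u v => InnerProductSpace.toDual_symm_apply
  refine ⟨fun u => (InnerProductSpace.toDual ℂ E).symm (φ u), fun u v => ?_, fun u => ?_,
    fun u v => ?_⟩
  · rw [hφ]; exact hcs u v
  · rw [hφ]; exact hself u
  · rw [hφ]; exact hsub u v

/-- Testing weak convergence against the vector `S y` that represents `n`: `n y ^ 2` is the limit of
`Re ⟪S y, x k⟫ ≤ n y * m`. -/
theorem le_of_tendsto_inner {E : Type*} [NormedAddCommGroup E]
    [InnerProductSpace ℂ E] [CompleteSpace E] {n : E → ℝ} (hn : IsHilbertianNorm n)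
    (he : IsEquivalentNorm n) {x : ℕ → E} {y : E} {m : ℝ} (hx : ∀ k, n (x k) ≤ m)
    (h : ∀ f, Tendsto (fun k => inner ℂ f (x k)) atTop (𝓝 (inner ℂ f y))) : n y ≤ m := by
  obtain ⟨S, hS, hS', -⟩ := hn.exists_representation he
  have hy := hn.nonneg y
  have hm : 0 ≤ m := (hn.nonneg (x 0)).trans (hx 0)
  have h1 : n y ^ 2 ≤ n y * m := by
    refine le_of_tendsto ((Complex.continuous_re.tendsto _).comp (h (S y)) |>.trans_eq ?_)
      (Eventually.of_forall fun k => ?_)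
    · rw [hS']
    · exact (Complex.re_le_norm _).trans ((hS y (x k)).trans (by gcongr; exact hx k))
  by_contra! h2
  have : 0 < n y := hm.trans_lt h2
  nlinarith

theorem isHilbertianNorm_norm {E : Type*} [NormedAddCommGroup E] [InnerProductSpace ℂ E] :
    IsHilbertianNorm (fun u : E => ‖u‖) :=
  ⟨InnerProductSpace.toCore, fun u => norm_eq_sqrt_re_inner (𝕜 := ℂ) u⟩

theorem isEquivalentNorm_norm {E : Type*} [NormedAddCommGroup E] :
    IsEquivalentNorm (fun u : E => ‖u‖) :=
  ⟨1, one_pos, fun u => by simp⟩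

theorem ContinuousLinearMap.denseRange_of_inner {E F : Type*} [NormedAddCommGroup E]
    [InnerProductSpace ℂ E] [CompleteSpace E] [NormedAddCommGroup F] [InnerProductSpace ℂ F]
    (T : F →L[ℂ] E) (h : ∀ f, (∀ g, inner ℂ (T g) f = 0) → f = 0) : DenseRange T := by
  have h1 : Dense ((LinearMap.range T.toLinearMap : Submodule ℂ E) : Set E) := by
    rw [Submodule.dense_iff_topologicalClosure_eq_top, Submodule.topologicalClosure_eq_top_iff,
      eq_bot_iff]
    intro f hf
    rw [Submodule.mem_orthogonal] at hf
    exact h f fun g => hf _ ⟨g, rfl⟩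
  exact h1

/-! ### Weak limits in `E` of sequences converging in `H`. -/

namespace Evolution

variable {E H : Type*} [NormedAddCommGroup E] [InnerProductSpace ℂ E] [CompleteSpace E]
  [NormedAddCommGroup H] [InnerProductSpace ℂ H] [CompleteSpace H]

theorem denseRange_adjoint {ι : E →L[ℂ] H} (hι : Function.Injective ι) :
    DenseRange (ContinuousLinearMap.adjoint ι) := by
  refine ContinuousLinearMap.denseRange_of_inner _ fun f hf => hι ?_
  rw [map_zero]
  refine ext_inner_left ℂ fun g => ?_
  rw [← ContinuousLinearMap.adjoint_inner_left, hf, inner_zero_right]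

theorem denseRange_gram {ι : E →L[ℂ] H} (hι : Function.Injective ι) : DenseRange (gram ι) := by
  refine ContinuousLinearMap.denseRange_of_inner _ fun f hf => hι ?_
  have := hf f
  rw [inner_gram_left, inner_self_eq_zero] at this
  rw [this, map_zero]

/-- A bounded sequence of `E` which converges in `H` converges weakly in `E`. -/
theorem exists_weak_limit {ι : E →L[ℂ] H} (hι : Function.Injective ι) {x : ℕ → E} {M : ℝ}
    (hM : ∀ k, ‖x k‖ ≤ M) {v : H} (hv : Tendsto (fun k => ι (x k)) atTop (𝓝 v)) :
    ∃ y, ι y = v ∧ ∀ f, Tendsto (fun k => inner ℂ f (x k)) atTop (𝓝 (inner ℂ f y)) := by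
  have hM0 : 0 ≤ M := (norm_nonneg _).trans (hM 0)
  have hadj : ∀ g, Tendsto (fun k => inner ℂ (x k) (ContinuousLinearMap.adjoint ι g)) atTop
      (𝓝 (inner ℂ v g)) := by
    intro g
    simp only [ContinuousLinearMap.adjoint_inner_right]
    exact hv.inner tendsto_const_nhds
  have hcauchy : ∀ f, CauchySeq fun k => inner ℂ (x k) f := by
    intro f
    rw [Metric.cauchySeq_iff]
    intro ε hε
    -- Pairings with vectors `ι* g` converge by convergence in `H`; such vectors are dense and the
    -- sequence is bounded.
    obtain ⟨g, hg⟩ := (denseRange_adjoint hι).exists_dist_lt f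
      (show 0 < ε / (3 * (M + 1)) by positivity)
    set f' := ContinuousLinearMap.adjoint ι g with hf'
    obtain ⟨K, hK⟩ := Metric.cauchySeq_iff.mp (hadj g).cauchySeq (ε / 3) (by positivity)
    refine ⟨K, fun m hm n hn => ?_⟩
    have h1 : ∀ k, dist (inner ℂ (x k) f) (inner ℂ (x k) f') ≤ ε / 3 := by
      intro k
      rw [dist_eq_norm, ← inner_sub_right]
      refine (norm_inner_le_norm _ _).trans ?_
      rw [dist_eq_norm] at hg
      calc _ ≤ M * (ε / (3 * (M + 1))) := mul_le_mul (hM k) hg.le (norm_nonneg _) hM0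
        _ ≤ (M + 1) * (ε / (3 * (M + 1))) := by gcongr; linarith
        _ = ε / 3 := by field_simp
    have h2 := hK m hm n hn
    have h3 := h1 n
    rw [dist_comm] at h3
    linarith [h1 m, dist_triangle4 (inner ℂ (x m) f) (inner ℂ (x m) f') (inner ℂ (x n) f')
      (inner ℂ (x n) f)]
  choose l hl using fun f => cauchySeq_tendsto_of_complete (hcauchy f)
  have hl' : Tendsto (fun k f => (innerSL ℂ (x k)) f) atTop (𝓝 l) := tendsto_pi_nhds.mpr hl
  let φ : E →L[ℂ] ℂ := continuousLinearMapOfTendsto _ hl'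
  have hy : ∀ f, inner ℂ ((InnerProductSpace.toDual ℂ E).symm φ) f = l f := fun f =>
    InnerProductSpace.toDual_symm_apply
  refine ⟨(InnerProductSpace.toDual ℂ E).symm φ, ?_, fun f => ?_⟩
  · refine ext_inner_right ℂ fun g => ?_
    rw [← ContinuousLinearMap.adjoint_inner_right, hy]
    exact tendsto_nhds_unique (hl _) (hadj g)
  · have h1 := (continuous_star.tendsto _).comp (hl f)
    rw [← hy f] at h1
    have h2 : ∀ x y : E, star (inner ℂ x y) = inner ℂ y x := fun x y => inner_conj_symm y x
    simpa only [Function.comp_def, h2] using h1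

theorem tendsto_inner_of_tendsto {ι : E →L[ℂ] H} (hι : Function.Injective ι) {x : ℕ → E} {M : ℝ}
    (hM : ∀ k, ‖x k‖ ≤ M) {y : E} (hy : Tendsto (fun k => ι (x k)) atTop (𝓝 (ι y))) (f : E) :
    Tendsto (fun k => inner ℂ f (x k)) atTop (𝓝 (inner ℂ f y)) := by
  obtain ⟨z, hz, h⟩ := exists_weak_limit hι hM hy
  rw [← hι hz]
  exact h f

theorem norm_le_of_tendsto {ι : E →L[ℂ] H} (hι : Function.Injective ι) {x : ℕ → E} {M : ℝ}
    (hM : ∀ k, ‖x k‖ ≤ M) {y : E} (hy : Tendsto (fun k => ι (x k)) atTop (𝓝 (ι y))) : ‖y‖ ≤ M :=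
  le_of_tendsto_inner isHilbertianNorm_norm isEquivalentNorm_norm hM
    (tendsto_inner_of_tendsto hι hM hy)

/-! ### Equicontinuity and convergence of the approximations. -/

namespace IsStableFamily

variable {ι : E →L[ℂ] H} {a b c : ℝ} {B : ℝ → E →L[ℂ] E} {G : ℝ → ℝ → E →L[ℂ] E}
  {N : ℝ → E → ℝ}

/-- Approximate solutions with a given value at `s` are equicontinuous at `s`. -/
theorem exists_forall_norm_sub_le (F : IsStableFamily ι a b c B G N) {s : ℝ} (hs : s ∈ Icc a b)
    (ψ : E) {η : ℝ} (hη : 0 < η) :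
    ∃ δ > 0, ∀ ε u, ε ≤ 1 → IsApproxSol ι B ε a b u → u s = ψ →
      (∀ t ∈ Icc a b, N t (u t) ≤ Real.exp (2 * c * |t - s|) * N s ψ) →
      ∀ t ∈ Icc a b, |t - s| < δ → ‖u t - ψ‖ ≤ η := by
  obtain ⟨C, hC, hCN⟩ := F.exists_norm_equivalence
  obtain ⟨C', hC', hM⟩ := F.exists_norm_le
  obtain ⟨L, hL⟩ := isCompact_Icc.exists_bound_of_continuousOn F.continuousOn
  obtain ⟨S, -, -, hS⟩ := (F.hilbertian s hs).exists_representation (F.equivalent s hs)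
  set M := C' * ‖ψ‖ with hMdef
  have hM0 : 0 ≤ M := by positivity
  -- Only `gram ι (u t)` has a Lipschitz bound in `E`, so the test vector `S ψ` is replaced by a
  -- nearby `gram ι g`, which moves the Gram operator onto `u t - ψ`.
  obtain ⟨g, hg⟩ := (denseRange_gram F.injective).exists_dist_lt (S ψ)
    (show 0 < η ^ 2 / (8 * C ^ 2 * (M + 1)) by positivity)
  rw [dist_eq_norm] at hg
  have hcont : Tendsto (fun x : ℝ => (Real.exp (6 * c * x) - 1) * N s ψ ^ 2 +
      2 * (‖g‖ * ((1 + L) * M * x))) (𝓝 0) (𝓝 0) := by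
    have : Continuous fun x : ℝ => (Real.exp (6 * c * x) - 1) * N s ψ ^ 2 +
      2 * (‖g‖ * ((1 + L) * M * x)) := by fun_prop
    simpa using this.tendsto 0
  obtain ⟨δ, hδ, h⟩ := Metric.tendsto_nhds_nhds.mp hcont (η ^ 2 / (2 * C ^ 2)) (by positivity)
  refine ⟨δ, hδ, fun ε u hε hu hus hN t ht hts => ?_⟩
  have h1 := h (x := |t - s|) (by simpa using hts)
  rw [dist_zero_right, Real.norm_eq_abs] at h1
  have h1 := (le_abs_self _).trans_lt h1
  have hb : ∀ t ∈ Icc a b, ‖u t‖ ≤ M := fun t ht => hM s hs t ht ψ _ (hN t ht)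
  have hψ : ‖ψ‖ ≤ M := by rw [← hus]; exact hb s hs
  -- The stability bound gives `2c` and the return from `N t` to `N s` adds `c`; squaring produces
  -- the `6c` used in choosing `δ`.
  have h2 : N s (u t) ≤ Real.exp (3 * c * |t - s|) * N s ψ := by
    calc _ ≤ Real.exp (c * |s - t|) * (Real.exp (2 * c * |t - s|) * N s ψ) :=
          (F.lip s hs t ht _).trans (by gcongr; exact hN t ht)
      _ = _ := by rw [abs_sub_comm, ← mul_assoc, ← Real.exp_add]; ring_nf
  have h3 : N s (u t) ^ 2 ≤ Real.exp (6 * c * |t - s|) * N s ψ ^ 2 := by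
    calc _ ≤ (Real.exp (3 * c * |t - s|) * N s ψ) ^ 2 :=
          pow_le_pow_left₀ ((F.hilbertian s hs).nonneg _) h2 2
      _ = _ := by rw [mul_pow, ← Real.exp_nat_mul]; push_cast; ring_nf
  have h4 : ‖gram ι (u t) - gram ι ψ‖ ≤ (1 + L) * M * |t - s| := by
    have h5 := hu.norm_gram_sub_le hb hL hs ht
    rw [hus] at h5
    refine h5.trans ?_
    gcongr
  have h5 : -(inner ℂ (S ψ) (u t - ψ)).re ≤ η ^ 2 / (8 * C ^ 2 * (M + 1)) * (2 * M) +
      ‖g‖ * ((1 + L) * M * |t - s|) := by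
    have e : inner ℂ (S ψ) (u t - ψ) = inner ℂ (S ψ - gram ι g) (u t - ψ) +
        inner ℂ g (gram ι (u t) - gram ι ψ) := by
      rw [inner_sub_left, ← map_sub, inner_gram, inner_gram_left]; ring
    rw [e, ← Complex.neg_re]
    refine (Complex.re_le_norm _).trans ?_
    rw [norm_neg]
    refine (norm_add_le _ _).trans (add_le_add ?_ ?_)
    · refine (norm_inner_le_norm _ _).trans (mul_le_mul hg.le ?_ (norm_nonneg _) (by positivity))
      linarith [norm_sub_le (u t) ψ, hb t ht]
    · exact (norm_inner_le_norm _ _).trans (mul_le_mul_of_nonneg_left h4 (norm_nonneg _))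
  have h6 : 4 * M * (η ^ 2 / (8 * C ^ 2 * (M + 1))) ≤ η ^ 2 / (2 * C ^ 2) := by
    calc _ ≤ 4 * (M + 1) * (η ^ 2 / (8 * C ^ 2 * (M + 1))) := by gcongr; linarith
      _ = _ := by field_simp; norm_num
  have h7 : N s (u t - ψ) ^ 2 ≤ η ^ 2 / C ^ 2 := by
    have e : η ^ 2 / C ^ 2 = η ^ 2 / (2 * C ^ 2) + η ^ 2 / (2 * C ^ 2) := by field_simp; norm_num
    rw [hS, e]
    linarith
  have h8 : (C * N s (u t - ψ)) ^ 2 ≤ η ^ 2 := by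
    rw [mul_pow, mul_comm]
    exact (le_div_iff₀ (by positivity)).mp h7
  exact (hCN s hs _).2.trans (abs_le_of_sq_le_sq' h8 hη.le).2

end IsStableFamily

/-- `y` is the limit, in `H`, of approximate solutions with value `ψ` at `s` that satisfy the
stability estimate, and satisfies this estimate itself. -/
structure IsLimitSol (ι : E →L[ℂ] H) (B : ℝ → E →L[ℂ] E) (N : ℝ → E → ℝ) (a b c s : ℝ) (ψ : E)
    (w : ℕ → ℝ → E) (y : ℝ → E) : Prop where
  approx : ∀ n : ℕ, IsApproxSol ι B (1 / ((n : ℝ) + 1)) a b (w n)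
  init : ∀ n, w n s = ψ
  bound : ∀ n, ∀ t ∈ Icc a b, N t (w n t) ≤ Real.exp (2 * c * |t - s|) * N s ψ
  tendsto : ∀ t ∈ Icc a b, Tendsto (fun n => ι (w n t)) atTop (𝓝 (ι (y t)))

namespace IsStableFamily

variable {ι : E →L[ℂ] H} {a b c s : ℝ} {B : ℝ → E →L[ℂ] E} {G : ℝ → ℝ → E →L[ℂ] E}
  {N : ℝ → E → ℝ}

/-- Two approximations agree at `s`, so the energy estimate makes them Cauchy in `H` at each `t`;
their bound in `E` places the limit in the range of `ι`. -/
theorem exists_isLimitSol (F : IsStableFamily ι a b c B G N) (hs : s ∈ Icc a b) (ψ : E) :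
    ∃ w y, IsLimitSol ι B N a b c s ψ w y := by
  choose w hw hws hN using fun n : ℕ =>
    F.exists_isApproxSol (show (0 : ℝ) < 1 / ((n : ℝ) + 1) by positivity) hs ψ
  obtain ⟨C, hC, hM⟩ := F.exists_norm_le
  have hb : ∀ n, ∀ t ∈ Icc a b, ‖w n t‖ ≤ C * ‖ψ‖ := fun n t ht => hM s hs t ht ψ _ (hN n t ht)
  have hlim : ∀ t ∈ Icc a b, ∃ y, Tendsto (fun n => ι (w n t)) atTop (𝓝 (ι y)) := by
    intro t ht
    have hcauchy : CauchySeq fun n => ι (w n t) := by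
      rw [Metric.cauchySeq_iff]
      intro ε hε
      have h0 : Tendsto (fun n : ℕ => 4 * (C * ‖ψ‖) ^ 2 * (2 * (1 / ((n : ℝ) + 1))) * |t - s|) atTop
          (𝓝 0) := by
        simpa using (((tendsto_one_div_add_atTop_nhds_zero_nat (𝕜 := ℝ)).const_mul 2).const_mul
          (4 * (C * ‖ψ‖) ^ 2)).mul_const |t - s|
      obtain ⟨K, hK⟩ := (h0.eventually (gt_mem_nhds (show 0 < ε ^ 2 by positivity))).exists
      refine ⟨K, fun m hm n hn => ?_⟩
      have h1 := (hw m).norm_sq_sub_le (hw n) (hb m) (hb n) hs ht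
      rw [hws, hws] at h1
      have h2 : ∀ n ≥ K, 1 / ((n : ℝ) + 1) ≤ 1 / ((K : ℝ) + 1) := fun n hn =>
        Nat.one_div_le_one_div hn
      have h3 : ‖ι (w m t - w n t)‖ ^ 2 < ε ^ 2 := by
        simp only [sub_self, map_zero, norm_zero, ne_eq, OfNat.ofNat_ne_zero, not_false_eq_true,
          zero_pow, sub_zero] at h1
        refine ((le_abs_self _).trans h1).trans_lt (lt_of_le_of_lt ?_ hK)
        gcongr
        linarith [h2 m hm, h2 n hn]
      rw [dist_eq_norm, ← map_sub]
      exact lt_of_pow_lt_pow_left₀ 2 hε.le h3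
    obtain ⟨v, hv⟩ := cauchySeq_tendsto_of_complete hcauchy
    obtain ⟨y, hy, -⟩ := exists_weak_limit F.injective (fun n => hb n t ht) hv
    exact ⟨y, by rwa [hy]⟩
  choose! y hy using hlim
  exact ⟨w, y, hw, hws, hN, hy⟩

end IsStableFamily

/-! ### Regularity of the limit, at the initial time and then everywhere. -/

namespace IsLimitSol

variable {ι : E →L[ℂ] H} {a b c s t : ℝ} {B : ℝ → E →L[ℂ] E} {G : ℝ → ℝ → E →L[ℂ] E}
  {N : ℝ → E → ℝ} {ψ : E} {w w' : ℕ → ℝ → E} {y y' : ℝ → E}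

theorem exists_bound (F : IsStableFamily ι a b c B G N) (hs : s ∈ Icc a b)
    (h : IsLimitSol ι B N a b c s ψ w y) : ∃ M, 0 ≤ M ∧ ∀ n, ∀ t ∈ Icc a b, ‖w n t‖ ≤ M := by
  obtain ⟨C, hC, hM⟩ := F.exists_norm_le
  exact ⟨C * ‖ψ‖, by positivity, fun n t ht => hM s hs t ht ψ _ (h.bound n t ht)⟩

theorem apply_self (F : IsStableFamily ι a b c B G N) (hs : s ∈ Icc a b)
    (h : IsLimitSol ι B N a b c s ψ w y) : y s = ψ := by
  refine F.injective (tendsto_nhds_unique (h.tendsto s hs) ?_)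
  simp only [h.init]
  exact tendsto_const_nhds

theorem norm_le (F : IsStableFamily ι a b c B G N) (hs : s ∈ Icc a b) (ht : t ∈ Icc a b)
    (h : IsLimitSol ι B N a b c s ψ w y) : N t (y t) ≤ Real.exp (2 * c * |t - s|) * N s ψ := by
  obtain ⟨M, hM0, hM⟩ := h.exists_bound F hs
  exact le_of_tendsto_inner (F.hilbertian t ht) (F.equivalent t ht) (fun n => h.bound n t ht)
    (tendsto_inner_of_tendsto F.injective (fun n => hM n t ht) (h.tendsto t ht))

/-- The energy estimate is applied from `t₀` to `w n - w' n`: both sequences tend to `y t₀` in `H`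
at `t₀`, and the errors vanish. It transfers regularity at an initial time to every time. -/
theorem eqOn_restart (F : IsStableFamily ι a b c B G N) (hs : s ∈ Icc a b)
    (h : IsLimitSol ι B N a b c s ψ w y) {t₀ : ℝ} (ht₀ : t₀ ∈ Icc a b)
    (h' : IsLimitSol ι B N a b c t₀ (y t₀) w' y') : EqOn y y' (Icc a b) := by
  obtain ⟨M, hM0, hM⟩ := h.exists_bound F hs
  obtain ⟨M', hM0', hM'⟩ := h'.exists_bound F ht₀
  intro t ht
  have h1 : ∀ n : ℕ, ‖ι (w n t) - ι (w' n t)‖ ^ 2 ≤ ‖ι (w n t₀) - ι (w' n t₀)‖ ^ 2 +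
      4 * (max M M') ^ 2 * (1 / ((n : ℝ) + 1) + 1 / ((n : ℝ) + 1)) * |t - t₀| := by
    intro n
    have h2 := (h.approx n).norm_sq_sub_le (h'.approx n)
      (fun t ht => (hM n t ht).trans (le_max_left M M'))
      (fun t ht => (hM' n t ht).trans (le_max_right M M')) ht₀ ht
    rw [map_sub, map_sub] at h2
    linarith [le_abs_self (‖ι (w n t) - ι (w' n t)‖ ^ 2 - ‖ι (w n t₀) - ι (w' n t₀)‖ ^ 2)]
  have h0 := tendsto_one_div_add_atTop_nhds_zero_nat (𝕜 := ℝ)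
  have h2 := le_of_tendsto_of_tendsto' ((((h.tendsto t ht).sub (h'.tendsto t ht)).norm).pow 2)
    (((((h.tendsto t₀ ht₀).sub (h'.tendsto t₀ ht₀)).norm).pow 2).add
      (((h0.add h0).const_mul (4 * (max M M') ^ 2)).mul_const |t - t₀|)) h1
  rw [h'.apply_self F ht₀] at h2
  simp only [sub_self, norm_zero, ne_eq, OfNat.ofNat_ne_zero, not_false_eq_true, zero_pow, add_zero,
    mul_zero, zero_mul] at h2
  have h3 : ‖ι (y t) - ι (y' t)‖ = 0 := by
    have := le_antisymm h2 (sq_nonneg _)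
    exact pow_eq_zero_iff two_ne_zero |>.mp this
  exact F.injective (sub_eq_zero.mp (norm_eq_zero.mp h3))

theorem exists_forall_norm_sub_le (F : IsStableFamily ι a b c B G N) (hs : s ∈ Icc a b)
    (h : IsLimitSol ι B N a b c s ψ w y) {η : ℝ} (hη : 0 < η) :
    ∃ δ > 0, ∀ n, ∀ t ∈ Icc a b, |t - s| < δ → ‖w n t - ψ‖ ≤ η := by
  obtain ⟨δ, hδ, H⟩ := F.exists_forall_norm_sub_le hs ψ hη
  refine ⟨δ, hδ, fun n => H _ _ ?_ (h.approx n) (h.init n) (h.bound n)⟩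
  rw [div_le_one (by positivity)]
  linarith [n.cast_nonneg (α := ℝ)]

/-- The equicontinuity bound at `s` is uniform in `n` and survives the weak limit, since balls of
`E` are weakly closed. -/
theorem continuousWithinAt (F : IsStableFamily ι a b c B G N) (hs : s ∈ Icc a b)
    (h : IsLimitSol ι B N a b c s ψ w y) : ContinuousWithinAt y (Icc a b) s := by
  rw [Metric.continuousWithinAt_iff]
  intro η hη
  obtain ⟨δ, hδ, H⟩ := h.exists_forall_norm_sub_le F hs (half_pos hη)
  refine ⟨δ, hδ, fun t ht hts => ?_⟩
  rw [dist_eq_norm, h.apply_self F hs]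
  refine lt_of_le_of_lt ?_ (half_lt_self hη)
  refine norm_le_of_tendsto F.injective (fun n => H n t ht hts) ?_
  simp only [map_sub]
  exact (h.tendsto t ht).sub_const _

/-- The remainder of the first order expansion at `s` is small uniformly in `n`. Convergence of `ι
(w n t)` in `H` is enough to pass to the limit, because `gram ι` factors through `ι`. -/
theorem hasDerivWithinAt (F : IsStableFamily ι a b c B G N) (hs : s ∈ Icc a b)
    (h : IsLimitSol ι B N a b c s ψ w y) :
    HasDerivWithinAt (fun τ => gram ι (y τ)) (-Complex.I • B s (y s)) (Icc a b) s := by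
  obtain ⟨M, hM0, hM⟩ := h.exists_bound F hs
  rw [hasDerivWithinAt_iff_isLittleO, Asymptotics.isLittleO_iff]
  intro η hη
  obtain ⟨δ₁, hδ₁, H₁⟩ := h.exists_forall_norm_sub_le F hs
    (show 0 < η / (2 * (‖B s‖ + 1)) by positivity)
  obtain ⟨δ₂, hδ₂, H₂⟩ := Metric.continuousWithinAt_iff.mp (F.continuousOn s hs)
    (η / (2 * (M + 1))) (by positivity)
  set δ := min δ₁ δ₂ with hδ
  have hδ0 : 0 < δ := lt_min hδ₁ hδ₂
  filter_upwards [self_mem_nhdsWithin, mem_nhdsWithin_of_mem_nhds (Metric.ball_mem_nhds s hδ0)]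
    with t ht hts
  rw [Metric.mem_ball, Real.dist_eq] at hts
  -- The expansion is used only on the segment between `s` and `t`, where `B` and `w n` stay close
  -- to their values at `s`.
  have hsub : ∀ x ∈ Icc (min s t) (max s t), x ∈ Icc a b ∧ |x - s| < δ := by
    intro x hx
    refine ⟨⟨(le_min hs.1 ht.1).trans hx.1, hx.2.trans (max_le hs.2 ht.2)⟩, ?_⟩
    refine lt_of_le_of_lt ?_ hts
    exact abs_sub_left_of_mem_uIcc hx
  have h1 : ∀ n : ℕ, ‖ContinuousLinearMap.adjoint ι (ι (w n t)) - gram ι ψ -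
      (t - s) • (-Complex.I • B s ψ)‖ ≤ ((1 / ((n : ℝ) + 1) + η / (2 * (M + 1))) * M +
        ‖B s‖ * (η / (2 * (‖B s‖ + 1)))) * |t - s| := by
    intro n
    have h2 := ((h.approx n).mono (le_min hs.1 ht.1) (max_le hs.2 ht.2)).norm_gram_sub_add_le
      (s := s) (t := t) (η := η / (2 * (M + 1))) (κ := η / (2 * (‖B s‖ + 1)))
      (fun x hx => hM n x (hsub x hx).1) ⟨min_le_left _ _, le_max_left _ _⟩
      ⟨min_le_right _ _, le_max_right _ _⟩
      (fun x hx => by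
        rw [← dist_eq_norm]
        exact (H₂ (hsub x hx).1 ((hsub x hx).2.trans_le (min_le_right _ _))).le)
      (fun x hx => by
        rw [h.init]
        exact H₁ n x (hsub x hx).1 ((hsub x hx).2.trans_le (min_le_left _ _)))
    rwa [h.init] at h2
  have h0 := tendsto_one_div_add_atTop_nhds_zero_nat (𝕜 := ℝ)
  have h2 := le_of_tendsto_of_tendsto'
    ((((((ContinuousLinearMap.adjoint ι).continuous.tendsto _).comp (h.tendsto t ht)).sub_const
      (gram ι ψ)).sub_const ((t - s) • (-Complex.I • B s ψ))).norm)
    ((((h0.add_const (η / (2 * (M + 1)))).mul_const M).add_const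
      (‖B s‖ * (η / (2 * (‖B s‖ + 1))))).mul_const |t - s|) h1
  rw [h.apply_self F hs]
  refine h2.trans ?_
  rw [Real.norm_eq_abs]
  gcongr
  have e1 : (0 + η / (2 * (M + 1))) * M ≤ η / 2 := by
    calc _ ≤ (0 + η / (2 * (M + 1))) * (M + 1) := by gcongr; linarith
      _ = _ := by field_simp; ring
  have e2 : ‖B s‖ * (η / (2 * (‖B s‖ + 1))) ≤ η / 2 := by
    calc _ ≤ (‖B s‖ + 1) * (η / (2 * (‖B s‖ + 1))) := by gcongr; linarith
      _ = _ := by field_simp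
  linarith

end IsLimitSol

/-- `y` is a solution on `[a, b]` of `i ∂ₜ ι*ι y = B(t) y`. -/
structure IsSol (ι : E →L[ℂ] H) (B : ℝ → E →L[ℂ] E) (a b : ℝ) (y : ℝ → E) : Prop where
  continuousOn : ContinuousOn y (Icc a b)
  deriv : ∀ t ∈ Icc a b,
    HasDerivWithinAt (fun τ => gram ι (y τ)) (-Complex.I • B t (y t)) (Icc a b) t

theorem IsStableFamily.exists_isSol {ι : E →L[ℂ] H} {a b c s : ℝ} {B : ℝ → E →L[ℂ] E}
    {G : ℝ → ℝ → E →L[ℂ] E} {N : ℝ → E → ℝ} (F : IsStableFamily ι a b c B G N)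
    (hs : s ∈ Icc a b) (ψ : E) :
    ∃ y, IsSol ι B a b y ∧ y s = ψ ∧
      ∀ t ∈ Icc a b, N t (y t) ≤ Real.exp (2 * c * |t - s|) * N s ψ := by
  obtain ⟨w, y, h⟩ := F.exists_isLimitSol hs ψ
  refine ⟨y, ⟨fun t ht => ?_, fun t ht => ?_⟩, h.apply_self F hs, fun t ht => h.norm_le F hs ht⟩
  all_goals
    obtain ⟨w', y', h'⟩ := F.exists_isLimitSol ht (y t)
    have heq := h.eqOn_restart F hs ht h'
  · exact (h'.continuousWithinAt F ht).congr heq (heq ht)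
  · rw [heq ht]
    exact (h'.hasDerivWithinAt F ht).congr (fun x hx => by simp only [heq hx])
      (by simp only [heq ht])

/-! ### Conservation, uniqueness and linearity for exact solutions. -/

namespace IsSol

variable {ι : E →L[ℂ] H} {a b s t : ℝ} {B : ℝ → E →L[ℂ] E} {y z : ℝ → E}

theorem isApproxSol (hB : ∀ t ∈ Icc a b, ∀ f, (inner ℂ f (B t f)).im = 0)
    (h : IsSol ι B a b y) : IsApproxSol ι B 0 a b y :=
  ⟨h.continuousOn, fun t ht => ⟨B t, hB t ⟨ht.1, ht.2.le⟩, by simp,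
    (h.deriv t ⟨ht.1, ht.2.le⟩).mono_of_mem_nhdsWithin
      (mem_of_superset (Icc_mem_nhdsGE ht.2) (Icc_subset_Icc ht.1 le_rfl))⟩⟩

/-- Exact solutions have error `0`, so the energy estimate becomes an equality. -/
theorem norm_sub_eq (hB : ∀ t ∈ Icc a b, ∀ f, (inner ℂ f (B t f)).im = 0)
    (hy : IsSol ι B a b y) (hz : IsSol ι B a b z) (hs : s ∈ Icc a b) (ht : t ∈ Icc a b) :
    ‖ι (y t - z t)‖ = ‖ι (y s - z s)‖ := by
  obtain ⟨M, hM⟩ := isCompact_Icc.exists_bound_of_continuousOn hy.continuousOn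
  obtain ⟨M', hM'⟩ := isCompact_Icc.exists_bound_of_continuousOn hz.continuousOn
  have h := (hy.isApproxSol hB).norm_sq_sub_le (hz.isApproxSol hB)
    (fun t ht => (hM t ht).trans (le_max_left M M'))
    (fun t ht => (hM' t ht).trans (le_max_right M M')) hs ht
  rw [add_zero, mul_zero, zero_mul] at h
  have h2 := sub_eq_zero.mp (abs_nonpos_iff.mp h)
  exact (pow_left_inj₀ (norm_nonneg _) (norm_nonneg _) two_ne_zero).mp h2

theorem zero (ι : E →L[ℂ] H) (B : ℝ → E →L[ℂ] E) (a b : ℝ) : IsSol ι B a b 0 :=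
  ⟨continuousOn_const, fun t _ => by simpa using hasDerivWithinAt_const t (Icc a b) (0 : E)⟩

theorem norm_eq (hB : ∀ t ∈ Icc a b, ∀ f, (inner ℂ f (B t f)).im = 0)
    (hy : IsSol ι B a b y) (hs : s ∈ Icc a b) (ht : t ∈ Icc a b) : ‖ι (y t)‖ = ‖ι (y s)‖ := by
  simpa using hy.norm_sub_eq hB (zero ι B a b) hs ht

theorem eqOn (hι : Function.Injective ι) (hB : ∀ t ∈ Icc a b, ∀ f, (inner ℂ f (B t f)).im = 0)
    (hy : IsSol ι B a b y) (hz : IsSol ι B a b z) (hs : s ∈ Icc a b) (h : y s = z s) :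
    EqOn y z (Icc a b) := by
  intro t ht
  have h1 := hy.norm_sub_eq hB hz hs ht
  rw [h, sub_self, map_zero, norm_zero, norm_eq_zero, map_sub] at h1
  exact hι (sub_eq_zero.mp h1)

theorem add (hy : IsSol ι B a b y) (hz : IsSol ι B a b z) : IsSol ι B a b (y + z) :=
  ⟨hy.continuousOn.add hz.continuousOn, fun t ht => by
    simpa using (hy.deriv t ht).fun_add (hz.deriv t ht)⟩

theorem smul (r : ℂ) (hy : IsSol ι B a b y) : IsSol ι B a b (r • y) :=
  ⟨hy.continuousOn.const_smul r, fun t ht => by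
    have := (hy.deriv t ht).const_smul r
    simp only [Pi.smul_apply, map_smul]
    rw [smul_comm]
    exact this⟩

end IsSol

end Evolution

/-! ### Transfer between the rigging and the equation in `Hp`. -/

theorem IsUnitaryGroupOf.hasDerivAt {H : Type*} [NormedAddCommGroup H] [InnerProductSpace ℂ H]
    [CompleteSpace H] {A : H →ₗ.[ℂ] H} {W : ℝ → H →L[ℂ] H} (hW : IsUnitaryGroupOf A W)
    (ψ : A.domain) (τ : ℝ) :
    ∃ h : W τ ψ ∈ A.domain,
      HasDerivAt (fun σ => W σ ψ) (Complex.I • A ⟨W τ ψ, h⟩) τ := by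
  have h0 := (hW.generator ψ _).mpr ⟨ψ.2, rfl⟩
  have h1 : HasDerivAt (fun σ => W τ (W σ ψ)) (W τ (Complex.I • A ψ)) 0 :=
    ((W τ).restrictScalars ℝ).hasFDerivAt.comp_hasDerivAt 0 h0
  have h2 : (fun σ => W τ (W σ ψ)) = fun σ => W σ (W τ ψ) := by
    ext σ
    rw [← mul_apply_eq_comp, ← mul_apply_eq_comp, ← hW.add, ← hW.add, add_comm]
  obtain ⟨hd, he⟩ := (hW.generator (W τ ψ) (W τ (Complex.I • A ψ))).mp (h2 ▸ h1)
  refine ⟨hd, ?_⟩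
  rw [← he]
  have h3 : HasDerivAt (fun σ => W τ (W (σ - τ) ψ)) (W τ (Complex.I • A ψ)) τ :=
    HasDerivAt.comp_sub_const τ τ (by rwa [sub_self])
  convert h3 using 2 with σ
  rw [← mul_apply_eq_comp, ← hW.add, add_sub_cancel]

namespace HilbertRigging

variable {Hp H : Type*}
  [NormedAddCommGroup Hp] [InnerProductSpace ℂ Hp] [CompleteSpace Hp]
  [NormedAddCommGroup H] [InnerProductSpace ℂ H] [CompleteSpace H]

theorem norm_toMinus (R : HilbertRigging Hp H) (u : H) : ‖R.toMinus u‖ = R.minusNorm u :=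
  UniformSpace.Completion.norm_coe (E := R.PreMinus) u

theorem denseRange_toMinus (R : HilbertRigging Hp H) : DenseRange R.toMinus :=
  UniformSpace.Completion.denseRange_coe (α := R.PreMinus)

/-- Moving the inclusion across the inner product turns the supremum into a dual norm of `ι* u`,
attained at the unit vector along `ι* u` when this is nonzero. -/
theorem norm_adjoint_incl (R : HilbertRigging Hp H) (u : H) :
    ‖ContinuousLinearMap.adjoint R.incl u‖ = R.minusNorm u := by
  refine le_antisymm ?_ (Real.iSup_le (fun f => ?_) (norm_nonneg _))
  · set x := ContinuousLinearMap.adjoint R.incl u with hx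
    rcases eq_or_ne x 0 with h | h
    · rw [h, norm_zero]
      exact R.minusNorm_nonneg u
    · have hx0 : ‖x‖ ≠ 0 := norm_ne_zero_iff.mpr h
      have h1 : ‖((‖x‖⁻¹ : ℝ) : ℂ) • x‖ = 1 := by
        rw [norm_smul, Complex.norm_real, norm_inv, norm_norm, inv_mul_cancel₀ hx0]
      refine le_of_eq_of_le ?_ (le_ciSup (R.bddAbove_minusNorm u) ⟨_, h1⟩)
      simp only
      rw [← ContinuousLinearMap.adjoint_inner_right, ← hx, inner_smul_left, norm_mul,
        inner_self_eq_norm_sq_to_K]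
      simp only [RCLike.norm_conj, Complex.norm_real, norm_inv, norm_norm, norm_pow]
      simp only [Complex.coe_algebraMap, Complex.norm_real, norm_norm]
      field_simp
  · rw [← ContinuousLinearMap.adjoint_inner_right]
    refine (norm_inner_le_norm _ _).trans ?_
    rw [f.2, one_mul]

/-- The adjoint of the inclusion extends to an isometry of `H₋` into `H₊`. -/
theorem exists_isometry (R : HilbertRigging Hp H) :
    ∃ J : R.Minus →ₗᵢ[ℂ] Hp, ∀ u, J (R.toMinus u) = ContinuousLinearMap.adjoint R.incl u := by
  let f : H →ₗ[ℂ] Hp := (ContinuousLinearMap.adjoint R.incl).toLinearMap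
  let e : H →ₗ[ℂ] R.Minus := R.toMinus.toLinearMap
  have hd : DenseRange e := R.denseRange_toMinus
  have he : ∀ u, ‖f u‖ = ‖e u‖ := fun u => (R.norm_adjoint_incl u).trans (R.norm_toMinus u).symm
  have hJ : ∀ u, f.extendOfNorm e (e u) = f u := LinearMap.extendOfNorm_eq hd
    ⟨1, fun u => (he u).le.trans_eq (one_mul _).symm⟩
  refine ⟨⟨(f.extendOfNorm e).toLinearMap, fun x => ?_⟩, hJ⟩
  refine congrFun (hd.equalizer (g := fun x => ‖f.extendOfNorm e x‖) (h := fun x => ‖x‖)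
    (f.extendOfNorm e).continuous.norm continuous_norm (funext fun u => ?_)) x
  simp only [Function.comp_apply, hJ, he]

/-- Differentiability with a given derivative concerns only the norm of the remainder, which `J`
preserves; surjectivity of `J` plays no role. -/
theorem hasDerivWithinAt_isometry_iff (R : HilbertRigging Hp H) (J : R.Minus →ₗᵢ[ℂ] Hp)
    {f : ℝ → R.Minus} {D : R.Minus} {s : Set ℝ} {t : ℝ} :
    HasDerivWithinAt (fun τ => J (f τ)) (J D) s t ↔ HasDerivWithinAt f D s t := by
  rw [hasDerivWithinAt_iff_isLittleO, hasDerivWithinAt_iff_isLittleO,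
    ← Asymptotics.isLittleO_norm_left, ← Asymptotics.isLittleO_norm_left (f' := fun x' => f x' - f t - (x' - t) • D)]
  have : ∀ x, ‖J (f x) - J (f t) - (x - t) • J D‖ = ‖f x - f t - (x - t) • D‖ := by
    intro x
    rw [← J.norm_map, map_sub, map_sub]
    exact congrArg (fun z => ‖J (f x) - J (f t) - z‖)
      (J.toLinearMap.map_smul_of_tower (x - t) D).symm
  simp only [this]

/-- For `v` in the domain this is the generator equation pushed through `ι*`. Such `v` are dense in
`Hp`, and the exponential bound makes the derivatives converge uniformly on bounded time intervals.
-/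
theorem hasDerivAt_gram_frozen (R : HilbertRigging Hp H) {A : H →ₗ.[ℂ] H} (hA : IsSelfAdjoint A)
    {J : R.Minus →ₗᵢ[ℂ] Hp}
    (hJ : ∀ u, J (R.toMinus u) = ContinuousLinearMap.adjoint R.incl u)
    (hdense : Dense {u : Hp | R.incl u ∈ A.domain}) {B : Hp →L[ℂ] R.Minus}
    (hB : R.IsExtension A B) {S : ℝ → Hp →L[ℂ] Hp} (hS : ∀ τ, R.Restricts (expI A τ) (S τ))
    {C c : ℝ} (hC : 0 ≤ C) (hc : 0 ≤ c) (hbound : ∀ τ v, ‖S τ v‖ ≤ C * Real.exp (c * |τ|) * ‖v‖)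
    (v : Hp) (τ : ℝ) :
    HasDerivAt (fun τ => Evolution.gram R.incl (S τ v)) (Complex.I • J (B (S τ v))) τ := by
  have hD : ∀ v : Hp, R.incl v ∈ A.domain → ∀ τ,
      HasDerivAt (fun τ => Evolution.gram R.incl (S τ v)) (Complex.I • J (B (S τ v))) τ := by
    intro v hv τ
    obtain ⟨h1, h2⟩ := (isUnitaryGroupOf_expI hA).hasDerivAt ⟨_, hv⟩ τ
    simp only [← hS _ _] at h1 h2
    have h3 := ((ContinuousLinearMap.adjoint R.incl).restrictScalars ℝ).hasFDerivAt.comp_hasDerivAt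
      τ h2
    refine h3.congr_deriv ?_
    rw [hB _ h1, hJ]
    exact (ContinuousLinearMap.adjoint R.incl).map_smul _ _
  obtain ⟨w, hw, hwv⟩ := mem_closure_iff_seq_limit.mp (hdense v)
  refine hasDerivAt_of_tendstoUniformlyOn (l := atTop) (s := Metric.ball (0 : ℝ) (|τ| + 1))
    (f := fun n τ => Evolution.gram R.incl (S τ (w n))) (g' := fun τ => Complex.I • J (B (S τ v)))
    (f' := fun n τ => Complex.I • J (B (S τ (w n)))) Metric.isOpen_ball ?_
    (Eventually.of_forall fun n σ _ => hD (w n) (hw n) σ)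
    (fun σ _ => (((Evolution.gram R.incl).comp (S σ)).continuous.tendsto v).comp hwv)
    (by simp)
  rw [Metric.tendstoUniformlyOn_iff]
  intro ε hε
  set K := ‖B‖ * (C * Real.exp (c * (|τ| + 1))) with hK
  have hK0 : 0 ≤ K := by positivity
  filter_upwards [Metric.tendsto_nhds.mp hwv (ε / (K + 1)) (by positivity)] with n hn σ hσ
  rw [Metric.mem_ball, dist_zero_right, Real.norm_eq_abs] at hσ
  rw [dist_comm, dist_eq_norm] at hn
  rw [dist_eq_norm, ← smul_sub, norm_smul, Complex.norm_I, one_mul, ← map_sub, J.norm_map,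
    ← map_sub, ← map_sub]
  calc _ ≤ ‖B‖ * (C * Real.exp (c * |σ|) * ‖v - w n‖) :=
        (B.le_opNorm _).trans (by gcongr; exact hbound σ _)
    _ ≤ ‖B‖ * (C * Real.exp (c * (|τ| + 1)) * ‖v - w n‖) := by gcongr
    _ = K * ‖v - w n‖ := by rw [hK]; ring
    _ ≤ (K + 1) * ‖v - w n‖ := by gcongr; linarith
    _ < ε := by rwa [lt_div_iff₀ (by positivity), mul_comm] at hn

/-- On the dense subspace the pairing is `⟪ι f, A ι f⟫`, which is real; the condition is closed in
`f`. -/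
theorem inner_extension_im (R : HilbertRigging Hp H) {A : H →ₗ.[ℂ] H} (hA : IsSelfAdjoint A)
    {J : R.Minus →ₗᵢ[ℂ] Hp}
    (hJ : ∀ u, J (R.toMinus u) = ContinuousLinearMap.adjoint R.incl u)
    (hdense : Dense {u : Hp | R.incl u ∈ A.domain}) {B : Hp →L[ℂ] R.Minus}
    (hB : R.IsExtension A B) (f : Hp) : (inner ℂ f (J (B f))).im = 0 := by
  have hcl : IsClosed {f : Hp | (inner ℂ f (J (B f))).im = 0} :=
    isClosed_eq (Complex.continuous_im.comp
      (continuous_id.inner (J.continuous.comp B.continuous))) continuous_const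
  refine hcl.closure_subset_iff.mpr (fun u hu => ?_) (hdense f)
  rw [mem_ofPred_eq, hB u hu, hJ, ContinuousLinearMap.adjoint_inner_right]
  exact SelfAdjointGroup.inner_self_im hA ⟨_, hu⟩

/-- Uniqueness makes the solution maps linear and multiplicative on `Hp`; conservation makes them
isometric for the norm of `H`, so they extend to `H` by density. -/
theorem exists_isUnitaryPropagator (R : HilbertRigging Hp H) {a b : ℝ}
    {B : ℝ → Hp →L[ℂ] R.Minus} {J : R.Minus →ₗᵢ[ℂ] Hp}
    (hJ : ∀ u, J (R.toMinus u) = ContinuousLinearMap.adjoint R.incl u) {c : ℝ}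
    {G : ℝ → ℝ → Hp →L[ℂ] Hp} {N : ℝ → Hp → ℝ}
    (F : Evolution.IsStableFamily R.incl a b c (fun t => J.toContinuousLinearMap.comp (B t)) G N) :
    ∃ (U : ℝ → ℝ → H →L[ℂ] H) (Up : ℝ → ℝ → Hp →L[ℂ] Hp),
      R.IsUnitaryPropagator (Icc a b) B U Up ∧
      ∀ t ∈ Icc a b, ∀ s ∈ Icc a b, ∀ ψ : Hp,
        N t (Up t s ψ) ≤ Real.exp (2 * c * |t - s|) * N s ψ := by
  have hgram : ∀ x, J (R.toMinus (R.incl x)) = Evolution.gram R.incl x := fun x => hJ _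
  choose! y hy hys hyN using fun s (hs : s ∈ Icc a b) ψ => F.exists_isSol hs ψ
  obtain ⟨C, hC, hM⟩ := F.exists_norm_le
  have hUp : ∀ t s, t ∈ Icc a b → s ∈ Icc a b → ∃ P : Hp →L[ℂ] Hp, ∀ ψ, P ψ = y s ψ t := by
    intro t s ht hs
    refine ⟨LinearMap.mkContinuous ⟨⟨fun ψ => y s ψ t, fun ψ φ => ?_⟩, fun r ψ => ?_⟩ C
      fun ψ => ?_, fun ψ => rfl⟩
    · exact (hy s hs _).eqOn F.injective F.symm ((hy s hs ψ).add (hy s hs φ)) hs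
        (by simp [hys s hs]) ht
    · exact (hy s hs _).eqOn F.injective F.symm ((hy s hs ψ).smul r) hs
        (by simp [hys s hs]) ht
    · exact hM s hs t ht ψ _ (hyN s hs ψ t ht)
  choose! Up hUp using hUp
  have hiso : ∀ t s, t ∈ Icc a b → s ∈ Icc a b → ∀ ψ, ‖R.incl (Up t s ψ)‖ = ‖R.incl ψ‖ := by
    intro t s ht hs ψ
    rw [hUp t s ht hs, (hy s hs ψ).norm_eq F.symm hs ht, hys s hs]
  have hUpself : ∀ t ∈ Icc a b, ∀ ψ, Up t t ψ = ψ := fun t ht ψ => by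
    rw [hUp t t ht ht, hys t ht]
  have hUpmul : ∀ t ∈ Icc a b, ∀ s ∈ Icc a b, ∀ r ∈ Icc a b, ∀ ψ,
      Up t s (Up s r ψ) = Up t r ψ := by
    intro t ht s hs r hr ψ
    rw [hUp t s ht hs, hUp s r hs hr, hUp t r ht hr]
    exact (hy s hs _).eqOn F.injective F.symm (hy r hr ψ) hs (hys s hs _) ht
  have hU : ∀ t s, t ∈ Icc a b → s ∈ Icc a b →
      ∃ T : H →L[ℂ] H, ∀ ψ, R.incl (Up t s ψ) = T (R.incl ψ) := by
    intro t s ht hs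
    let f : Hp →ₗ[ℂ] H := (R.incl.comp (Up t s)).toLinearMap
    exact ⟨f.extendOfNorm R.incl.toLinearMap, fun ψ => (LinearMap.extendOfNorm_eq (f := f)
      R.denseRange_incl ⟨1, fun ψ => (hiso t s ht hs ψ).le.trans_eq (one_mul _).symm⟩ ψ).symm⟩
  choose! U hU using hU
  have hext : ∀ S T : H →L[ℂ] H, (∀ ψ, S (R.incl ψ) = T (R.incl ψ)) → S = T := fun S T h =>
    DFunLike.coe_injective (R.denseRange_incl.equalizer S.continuous T.continuous (funext h))
  have hUself : ∀ t ∈ Icc a b, U t t = 1 := fun t ht => hext _ _ fun ψ => by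
    rw [← hU t t ht ht, hUpself t ht, one_apply_eq_self]
  have hUmul : ∀ t ∈ Icc a b, ∀ s ∈ Icc a b, ∀ r ∈ Icc a b, U t s * U s r = U t r :=
    fun t ht s hs r hr => hext _ _ fun ψ => by
      rw [mul_apply_eq_comp, ← hU s r hs hr, ← hU t s ht hs, ← hU t r ht hr,
        hUpmul t ht s hs r hr]
  have hUnorm : ∀ t s, t ∈ Icc a b → s ∈ Icc a b → ∀ x, ‖U t s x‖ = ‖x‖ := by
    intro t s ht hs
    refine congrFun (R.denseRange_incl.equalizer (g := fun x => ‖U t s x‖) (h := fun x => ‖x‖)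
      (U t s).continuous.norm continuous_norm (funext fun ψ => ?_))
    simp only [Function.comp_apply, ← hU t s ht hs, hiso t s ht hs]
  refine ⟨U, Up, ⟨fun t ht s hs => ?_, hUself, hUmul, fun t ht s hs => hU t s ht hs,
    fun s hs ψ => ?_, fun s hs ψ t ht => ?_, fun s hs ψ => ?_⟩, fun t ht s hs ψ => ?_⟩
  -- Norm preservation yields only a left inverse; the propagator law supplies `U s t` as a right
  -- inverse.
  · have h1 : star (U t s) * U t s = 1 :=
      (ContinuousLinearMap.norm_map_iff_adjoint_comp_self (U t s)).mp (hUnorm t s ht hs)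
    have h2 : U t s * U s t = 1 := by rw [hUmul t ht s hs t ht, hUself t ht]
    have h3 : star (U t s) = U s t := by
      calc _ = star (U t s) * (U t s * U s t) := by rw [h2, mul_one]
        _ = _ := by rw [← mul_assoc, h1, one_mul]
    exact Unitary.mem_iff.mpr ⟨h1, by rw [h3, h2]⟩
  · exact (hy s hs ψ).continuousOn.congr fun t ht => hUp t s ht hs ψ
  · rw [← R.hasDerivWithinAt_isometry_iff J]
    simp only [hgram, map_smul, hUp t s ht hs]
    exact ((hy s hs ψ).deriv t ht).congr (fun τ hτ => by rw [hUp τ s hτ hs])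
      (by rw [hUp t s ht hs])
  · have h1 : ContinuousOn (fun t => -Complex.I • J (B t (Up t s ψ))) (Icc a b) := by
      refine (F.continuousOn.clm_apply ?_).const_smul _
      exact (hy s hs ψ).continuousOn.congr fun t ht => hUp t s ht hs ψ
    have h2 : ContinuousOn (fun t => J (-Complex.I • B t (Up t s ψ))) (Icc a b) := by
      simpa only [map_smul] using h1
    exact J.isometry.isUniformInducing.isInducing.continuousOn_iff.mpr h2
  · rw [hUp t s ht hs]
    exact hyN s hs ψ t ht

theorem IsUnitaryPropagator.isSol {R : HilbertRigging Hp H} {a b : ℝ}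
    {B : ℝ → Hp →L[ℂ] R.Minus} {J : R.Minus →ₗᵢ[ℂ] Hp}
    (hJ : ∀ u, J (R.toMinus u) = ContinuousLinearMap.adjoint R.incl u)
    {U : ℝ → ℝ → H →L[ℂ] H} {Up : ℝ → ℝ → Hp →L[ℂ] Hp}
    (h : R.IsUnitaryPropagator (Icc a b) B U Up) {s : ℝ} (hs : s ∈ Icc a b) (ψ : Hp) :
    Evolution.IsSol R.incl (fun t => J.toContinuousLinearMap.comp (B t)) a b
      (fun t => Up t s ψ) := by
  refine ⟨h.continuousOn s hs ψ, fun t ht => ?_⟩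
  have h1 := (R.hasDerivWithinAt_isometry_iff J).mpr (h.hasDeriv s hs ψ t ht)
  simp only [hJ, map_smul] at h1
  exact h1

/-- On `Hp` both propagators solve the same initial value problem, and `Hp` is dense in `H`. -/
theorem IsUnitaryPropagator.eq {R : HilbertRigging Hp H} {a b : ℝ}
    {B : ℝ → Hp →L[ℂ] R.Minus} {J : R.Minus →ₗᵢ[ℂ] Hp}
    (hJ : ∀ u, J (R.toMinus u) = ContinuousLinearMap.adjoint R.incl u)
    (hsymm : ∀ t ∈ Icc a b, ∀ f, (inner ℂ f (J (B t f))).im = 0)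
    {U V : ℝ → ℝ → H →L[ℂ] H} {Up Vp : ℝ → ℝ → Hp →L[ℂ] Hp}
    (hU : R.IsUnitaryPropagator (Icc a b) B U Up) (hV : R.IsUnitaryPropagator (Icc a b) B V Vp)
    {t s : ℝ} (ht : t ∈ Icc a b) (hs : s ∈ Icc a b) : V t s = U t s := by
  refine DFunLike.coe_injective (R.denseRange_incl.equalizer (V t s).continuous
    (U t s).continuous (funext fun ψ => ?_))
  have hself : ∀ {W : ℝ → ℝ → H →L[ℂ] H} {Wp : ℝ → ℝ → Hp →L[ℂ] Hp},
      R.IsUnitaryPropagator (Icc a b) B W Wp → Wp s s ψ = ψ := fun hW => R.incl_injective (by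
    rw [hW.restricts s hs s hs, hW.self s hs, one_apply_eq_self])
  simp only [Function.comp_apply]
  rw [← hU.restricts t ht s hs, ← hV.restricts t ht s hs]
  exact congrArg R.incl ((hV.isSol hJ hs ψ).eqOn R.incl_injective hsymm (hU.isSol hJ hs ψ) hs
    ((hself hV).trans (hself hU).symm) ht)

end HilbertRigging

/-! ### Assembly of the main theorem. -/

theorem theoremC2 {Hp H : Type*}
    [NormedAddCommGroup Hp] [InnerProductSpace ℂ Hp] [CompleteSpace Hp]
    [NormedAddCommGroup H] [InnerProductSpace ℂ H] [CompleteSpace H]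
    (R : HilbertRigging Hp H) (a b : ℝ) (hab : a ≤ b)
    -- the self-adjoint operators `A t` and their extensions `B t` in `L(H₊, H₋)`
    (A : ℝ → H →ₗ.[ℂ] H) (B : ℝ → Hp →L[ℂ] R.Minus)
    (hA : ∀ t ∈ Set.Icc a b, IsSelfAdjoint (A t))
    (hdense : ∀ t ∈ Set.Icc a b, Dense {u : Hp | R.incl u ∈ (A t).domain})
    (hB : ∀ t ∈ Set.Icc a b, R.IsExtension (A t) (B t))
    -- norm continuity in `L(H₊, H₋)`
    (hcont : ContinuousOn B (Set.Icc a b))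
    -- `G t τ` is the restriction of `exp (i τ A t)` to `H₊`; it is strongly continuous in `τ`
    (G : ℝ → ℝ → Hp →L[ℂ] Hp)
    (hG : ∀ t ∈ Set.Icc a b, ∀ τ : ℝ, R.Restricts (expI (A t) τ) (G t τ))
    (hGcont : ∀ t ∈ Set.Icc a b, ∀ ψ : Hp, Continuous fun τ : ℝ => G t τ ψ)
    -- `N t` is the equivalent Hilbertian norm `‖·‖_t` on `H₊`
    (N : ℝ → Hp → ℝ)
    (hN : ∀ t ∈ Set.Icc a b, IsHilbertianNorm (N t))
    (hNequiv : ∀ t ∈ Set.Icc a b, IsEquivalentNorm (N t))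
    (c : ℝ) (hc : 0 < c)
    (hNlip : ∀ t ∈ Set.Icc a b, ∀ s ∈ Set.Icc a b, ∀ ψ : Hp,
      N t ψ ≤ Real.exp (c * |t - s|) * N s ψ)
    (hNexp : ∀ t ∈ Set.Icc a b, ∀ (τ : ℝ) (ψ : Hp),
      N t (G t τ ψ) ≤ Real.exp (c * |τ|) * N t ψ) :
    ∃ (U : ℝ → ℝ → H →L[ℂ] H) (Up : ℝ → ℝ → Hp →L[ℂ] Hp),
      R.IsUnitaryPropagator (Set.Icc a b) B U Up ∧
      (∀ (V : ℝ → ℝ → H →L[ℂ] H) (Vp : ℝ → ℝ → Hp →L[ℂ] Hp),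
        R.IsUnitaryPropagator (Set.Icc a b) B V Vp →
        ∀ t ∈ Set.Icc a b, ∀ s ∈ Set.Icc a b, V t s = U t s) ∧
      ∀ t ∈ Set.Icc a b, ∀ s ∈ Set.Icc a b, ∀ ψ : Hp,
        N t (Up t s ψ) ≤ Real.exp (2 * c * |t - s|) * N s ψ := by
  obtain ⟨J, hJ⟩ := R.exists_isometry
  have hsymm : ∀ t ∈ Set.Icc a b, ∀ f, (inner ℂ f (J (B t f))).im = 0 := fun t ht =>
    R.inner_extension_im (hA t ht) hJ (hdense t ht) (hB t ht)
  have F : Evolution.IsStableFamily R.incl a b c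
      (fun t => J.toContinuousLinearMap.comp (B t)) G N := by
    refine ⟨R.incl_injective, hab, continuousOn_const.clm_comp hcont, hsymm, fun t ht => ?_,
      hGcont, fun t ht v τ => ?_, hN, hNequiv, hc, hNlip, hNexp⟩
    · refine ContinuousLinearMap.ext fun v => R.incl_injective ?_
      rw [hG t ht 0 v, (isUnitaryGroupOf_expI (hA t ht)).zero]; rfl
    · obtain ⟨C, hC, hCN⟩ := hNequiv t ht
      -- The group bound is stated for `N t`; passing to it and back to the norm of `Hp` costs `C`
      -- twice.
      refine R.hasDerivAt_gram_frozen (hA t ht) hJ (hdense t ht) (hB t ht) (hG t ht)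
        (C := C * C) (by positivity) hc.le (fun τ v => ?_) v τ
      calc _ ≤ C * N t (G t τ v) := (hCN _).2
        _ ≤ C * (Real.exp (c * |τ|) * (C * ‖v‖)) := by
          gcongr
          exact (hNexp t ht τ v).trans (by gcongr; exact (hCN v).1)
        _ = _ := by ring
  obtain ⟨U, Up, hU, hUN⟩ := R.exists_isUnitaryPropagator hJ F
  exact ⟨U, Up, hU, fun V Vp hV t ht s hs => hU.eq hJ hsymm hV ht hs, hUN⟩
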